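/- Everything is holomorphic, and $[\cdot,\cdot]$ of endomorphisms is the commutator. An $F$-manifold $(M,\circ,e,E)$ is a complex manifold with a commutative associative multiplication $\circ$ on $TM$ with unit field $e$ and an Euler field $E$ such that $L_{X\circ Y}(\circ)=X\circ L_Y(\circ)+Y\circ L_X(\circ)$ for all vector fields $X,Y$, and $L_E(\circ)(X,Y)=X\circ Y$. It is regular if at each point the endomorphism $X\mapsto E\circ X$ has equal minimal and characteristic polynomials, and globally nilpotent if multiplication by each tangent vector has exactly one eigenvalue. A metric $g$ (holomorphic, symmetric, non-degenerate) is multiplication invariant if $g(X\circ Y,Z)=g(X,Y\circ Z)$. Such a $g$ is Frobenius on $(M,\circ,e)$ if it is flat and $\nabla e=0$ for its Levi-Civita connection $\nabla$; it is Frobenius on $(M,\circ,e,E)$ if moreover $L_E g=Dg$ for some constant $D\in\mathbb C$. Let $M\subset\mathbb C^m$ ($m\ge 1$) be a connected open set, with coordinates $t^0,\dots,t^{m-1}$ and $\partial_i=\partial/\partial t^i$, carrying a regular globally nilpotent $F$-manifold structure for which these coordinates are canonical: with $\partial_k:=0$ for $k\ge m$, $$\partial_i\circ\partial_j=\partial_{i+j},\qquad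 e=\partial_0,\qquad E=(t^0+a)\partial_0+(t^1+1)\partial_1+\sum_{i\ge 2}t^i\partial_i$$ for a constant $a\in\mathbb C$ (if $m=1$, $E=(t^0+a)\partial_0$). Let $\epsilon=\sum_{i+j=m-1}dt^i\otimes dt^j$. Through the isomorphism $TM\cong T^*M$ given by $\epsilon$, the multiplication and $\epsilon$ are transferred to $T^*M$ and denoted by the same symbols. Let $C_i$ be the multiplication by $\partial_i$. Let $g$ be a multiplication invariant metric, put $\eta_k=g(\partial_k,e)$, so that $g=\sum_{i,j}\eta_{i+j}\,dt^i\otimes dt^j$ with $\eta_k=0$ for $k\ge m$, and fix a holomorphic branch $(\eta_{m-1})^{1/2}$ on $M$. (i) There is a unique invertible $1$-form $\psi=\sum_j\psi_j\,dt^j$ with $\psi_{m-1}=(\eta_{m-1})^{1/2}$ and $g(X,Y)=(\psi\circ\psi)(X\circ Y)$ for all $X,Y$. Its other components satisfy, and are determined inductively by, $$\sum_{s+t=(m-1)+k,\ 0\le s,t\le m-1}\psi_s\psi_t=\eta_k,\qquad 0\le k\le m-2 .$$ (ii) Let $\beta=\sum_s\beta_s\,dt^s$ be the inverse of $\psi$.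 The metric $g$ is Frobenius on $(M,\circ,e)$ if and only if $\epsilon(\psi,\psi)=\sum_{i+j=m-1}\psi_i\psi_j$ is constant and the endomorphism $$\gamma=\sum_{j=0}^{m-1}\ \sum_{0\le i\le s\le m-1}\beta_s\,\partial_{m-1-i}(\psi_j)\,\partial_{m-1+i-s}\otimes dt^j$$ is $\epsilon$-symmetric and satisfies the generalized Darboux–Egoroff equations $$[C_i,L_{\partial_j}(\gamma)]-[C_j,L_{\partial_i}(\gamma)]-[[C_i,\gamma],[C_j,\gamma]]=0,\qquad 0\le i,j\le m-1 .$$ In particular, if $g$ is Frobenius on $(M,\circ,e)$, then locally there is a function $H$ with $\eta_i=\partial_iH$ for all $i$, and the $\partial_iH$ are independent of $t^0$. (iii) The metric $g$ is Frobenius on $(M,\circ,e,E)$ if and only if the conditions of (ii) hold and, moreover, there is a constant $D\in\mathbb C$ with $E(\eta_i)=(D-2)\eta_i$ for all $i$; for each $D$, the latter condition then corresponds to $L_Eg=Dg$. -/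

import Mathlib

open Finset

noncomputable section

namespace FMan

/-- The coordinate space `ℂ^m`, with coordinates `t^0, …, t^{m-1}`. It is also the tangent space at
each of its points; a tensor field on an open set is given by its value at each point. -/
abbrev Sp (m : ℕ) := Fin m → ℂ

/-- Vector fields. -/
abbrev VF (m : ℕ) := Sp m → Sp m

/-- `1`-forms. -/
abbrev OneForm (m : ℕ) := Sp m → (Sp m →L[ℂ] ℂ)

/-- Fields of endomorphisms of the tangent bundle. -/
abbrev EndField (m : ℕ) := Sp m → (Sp m →L[ℂ] Sp m)

/-- Fields of bilinear forms, i.e. sections of `T^* ⊗ T^*`. -/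
abbrev BilField (m : ℕ) := Sp m → (Sp m →L[ℂ] Sp m →L[ℂ] ℂ)

/-- Fields of bilinear products on the tangent bundle, i.e. `(1,2)`-tensors. -/
abbrev MulField (m : ℕ) := Sp m → (Sp m →L[ℂ] Sp m →L[ℂ] Sp m)

/-- The coordinate vector `∂_k`, with the convention `∂_k = 0` for `k ≥ m`. -/
def dd (m k : ℕ) : Sp m := fun i => if (i : ℕ) = k then 1 else 0

/-- The coordinate covector `dt^k`, with the convention `dt^k = 0` for `k ≥ m`. -/
def dt (m k : ℕ) : Sp m →L[ℂ] ℂ :=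
  if h : k < m then ContinuousLinearMap.proj (⟨k, h⟩ : Fin m) else 0

variable {m : ℕ} {U : Set (Sp m)}

/-! ### Lie derivatives, in coordinates -/

/-- `(L_X ∘)(u, v) = [X, u ∘ v] - [X, u] ∘ v - u ∘ [X, v]`; this is tensorial in `u`, `v`, which are
extended to vector fields with constant components. -/
def lieMul (X : VF m) (c : MulField m) (p u v : Sp m) : Sp m :=
  VectorField.lieBracket ℂ X (fun q => c q u v) p
    - c p (VectorField.lieBracket ℂ X (fun _ => u) p) v
    - c p u (VectorField.lieBracket ℂ X (fun _ => v) p)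

/-- `(L_X g)(u, v) = X (g(u, v)) - g([X, u], v) - g(u, [X, v])`, with `u`, `v` extended to vector
fields with constant components. -/
def lieBil (X : VF m) (g : BilField m) (p u v : Sp m) : ℂ :=
  fderiv ℂ (fun q => g q u v) p (X p)
    - g p (VectorField.lieBracket ℂ X (fun _ => u) p) v
    - g p u (VectorField.lieBracket ℂ X (fun _ => v) p)

/-- The Lie derivative of a field of endomorphisms along the coordinate vector field `∂_k`: the
derivative of its components with respect to `t^k`. -/
def lieEnd (k : ℕ) (A : EndField m) : EndField m := fun p => fderiv ℂ A p (dd m k)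

/-! ### `F`-manifolds -/

/-- A holomorphic `F`-manifold structure `(∘, e, E)` with Euler field on an open set `U ⊆ ℂ^m`. -/
structure FStructure (m : ℕ) (U : Set (Sp m)) where
  /-- the multiplication `∘` -/
  mul : MulField m
  /-- the unit field -/
  e : VF m
  /-- the Euler field -/
  E : VF m
  isOpen : IsOpen U
  mul_holo : AnalyticOnNhd ℂ mul U
  e_holo : AnalyticOnNhd ℂ e U
  E_holo : AnalyticOnNhd ℂ E U
  mul_comm : ∀ p ∈ U, ∀ u v, mul p u v = mul p v u
  mul_assoc : ∀ p ∈ U, ∀ u v w, mul p (mul p u v) w = mul p u (mul p v w)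
  e_mul : ∀ p ∈ U, ∀ u, mul p (e p) u = u
  /-- `L_{X ∘ Y}(∘) = X ∘ L_Y(∘) + Y ∘ L_X(∘)` for all local holomorphic vector fields -/
  integr : ∀ p ∈ U, ∀ X Y : VF m, AnalyticAt ℂ X p → AnalyticAt ℂ Y p → ∀ u v,
    lieMul (fun q => mul q (X q) (Y q)) mul p u v
      = mul p (X p) (lieMul Y mul p u v) + mul p (Y p) (lieMul X mul p u v)
  /-- `L_E(∘)(u, v) = u ∘ v` -/
  euler : ∀ p ∈ U, ∀ u v, lieMul E mul p u v = mul p u v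

/-- Regularity: at each point the endomorphism `X ↦ E ∘ X` is regular, i.e. its minimal polynomial
is its characteristic polynomial. -/
def FStructure.IsRegular (F : FStructure m U) : Prop :=
  ∀ p ∈ U, minpoly ℂ (F.mul p (F.E p) : Sp m →ₗ[ℂ] Sp m)
    = LinearMap.charpoly (F.mul p (F.E p) : Sp m →ₗ[ℂ] Sp m)

/-- Global nilpotency: multiplication by any tangent vector has exactly one eigenvalue. -/
def FStructure.IsGloballyNilpotent (F : FStructure m U) : Prop :=
  ∀ p ∈ U, ∀ u, ∃! μ : ℂ,
    Module.End.HasEigenvalue (F.mul p u : Sp m →ₗ[ℂ] Sp m) μ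

/-- The coordinates of `ℂ^m` are canonical for the regular globally nilpotent structure `F`:
`∂_i ∘ ∂_j = ∂_{i+j}` (which is `0` if `i + j ≥ m`), `e = ∂_0`, and
`E = (t^0 + a) ∂_0 + (t^1 + 1) ∂_1 + t^2 ∂_2 + ⋯ + t^{m-1} ∂_{m-1}` for a constant `a`
(the `∂_1` term being absent if `m = 1`). -/
structure FStructure.IsCanonical (F : FStructure m U) : Prop where
  mul_eq : ∀ p ∈ U, ∀ i j, F.mul p (dd m i) (dd m j) = dd m (i + j)
  e_eq : ∀ p ∈ U, F.e p = dd m 0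
  E_eq : ∃ a : ℂ, ∀ p ∈ U, F.E p = p + a • dd m 0 + dd m 1

/-! ### Metrics -/

/-- A holomorphic metric: a holomorphic, symmetric, non-degenerate field of bilinear forms. -/
structure IsMetric (U : Set (Sp m)) (g : BilField m) : Prop where
  holo : AnalyticOnNhd ℂ g U
  symm : ∀ p ∈ U, ∀ u v, g p u v = g p v u
  nondeg : ∀ p ∈ U, ∀ u, (∀ v, g p u v = 0) → u = 0

/-- Multiplication invariance of `g`. -/
def FStructure.IsInvariant (F : FStructure m U) (g : BilField m) : Prop :=
  ∀ p ∈ U, ∀ u v w, g p (F.mul p u v) w = g p u (F.mul p v w)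

/-- `∇ = d + Γ`, i.e. `∇_X Y = dY(X) + Γ(X, Y)`, is the Levi-Civita connection of `g` on `U`:
it is holomorphic, torsion free and metric. -/
structure IsLeviCivita (U : Set (Sp m)) (g : BilField m) (Γ : MulField m) : Prop where
  holo : AnalyticOnNhd ℂ Γ U
  torsion_free : ∀ p ∈ U, ∀ u v, Γ p u v = Γ p v u
  metric : ∀ p ∈ U, ∀ w u v,
    fderiv ℂ (fun q => g q u v) p w = g p (Γ p w u) v + g p u (Γ p w v)

/-- The Levi-Civita connection of a metric is unique. -/
theorem IsLeviCivita.unique {g : BilField m} {Γ Γ' : MulField m} (hg : IsMetric U g)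
    (h : IsLeviCivita U g Γ) (h' : IsLeviCivita U g Γ') : Set.EqOn Γ Γ' U := by
  intro p hp
  ext1 u
  ext1 v
  refine sub_eq_zero.1 (hg.nondeg p hp _ fun w => ?_)
  have k : ∀ x y z, g p (Γ p x y - Γ' p x y) z = - g p (Γ p x z - Γ' p x z) y := by
    intro x y z
    have e1 := h.metric p hp x y z
    have e2 := h'.metric p hp x y z
    rw [hg.symm p hp _ y]
    simp only [map_sub, _root_.sub_apply]
    linear_combination e2 - e1
  have s : ∀ x y z, g p (Γ p x y - Γ' p x y) z = g p (Γ p y x - Γ' p y x) z := by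
    intro x y z
    rw [h.torsion_free p hp x y, h'.torsion_free p hp x y]
  have a1 := k u v w
  have a2 := s u w v
  have a3 := k w u v
  have a4 := s w v u
  have a5 := k v w u
  have a6 := s v u w
  have h2 : (2 : ℂ) * g p (Γ p u v - Γ' p u v) w = 0 := by
    linear_combination a1 - a2 - a3 + a4 + a5 - a6
  simpa using h2

/-- The curvature `R(u, v) w` of the connection `∇ = d + Γ`. -/
def curv (Γ : MulField m) (p u v w : Sp m) : Sp m :=
  fderiv ℂ (fun q => Γ q v w) p u - fderiv ℂ (fun q => Γ q u w) p v
    + Γ p u (Γ p v w) - Γ p v (Γ p u w)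

/-- `g` is a Frobenius metric on `(M, ∘, e)` (no Euler field): a multiplication invariant metric
whose Levi-Civita connection `∇` is flat and satisfies `∇ e = 0`. -/
def FStructure.IsFrobenius (F : FStructure m U) (g : BilField m) : Prop :=
  IsMetric U g ∧ F.IsInvariant g ∧ ∃ Γ : MulField m, IsLeviCivita U g Γ ∧
    (∀ p ∈ U, ∀ u v w, curv Γ p u v w = 0) ∧
    ∀ p ∈ U, ∀ u, fderiv ℂ F.e p u + Γ p u (F.e p) = 0

/-- `g` is a Frobenius metric on `(M, ∘, e, E)`, with `L_E g = D g` for the given constant `D`. -/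
def FStructure.IsFrobeniusEulerWith (F : FStructure m U) (g : BilField m) (D : ℂ) : Prop :=
  F.IsFrobenius g ∧ ∀ p ∈ U, ∀ u v, lieBil F.E g p u v = D * g p u v

/-- `g` is a Frobenius metric on `(M, ∘, e, E)`. -/
def FStructure.IsFrobeniusEuler (F : FStructure m U) (g : BilField m) : Prop :=
  ∃ D : ℂ, F.IsFrobeniusEulerWith g D

/-- The components `η_k = g(∂_k, e)` of the coidentity; `η_k = 0` for `k ≥ m`. -/
def FStructure.eta (F : FStructure m U) (g : BilField m) (k : ℕ) (p : Sp m) : ℂ :=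
  g p (dd m k) (F.e p)

/-! ### The constant metric `ε` and the induced structures on `1`-forms -/

/-- The constant metric `ε = ∑_{i+j=m-1} dt^i ⊗ dt^j`. -/
def eps (m : ℕ) : Sp m →L[ℂ] Sp m →L[ℂ] ℂ :=
  ∑ x ∈ antidiagonal (m - 1), (dt m x.1).smulRight (dt m x.2)

/-- The vector `ε^{-1}(ψ)` that is `ε`-dual to a covector `ψ`. -/
def sharp (ψ : Sp m →L[ℂ] ℂ) : Sp m :=
  ∑ x ∈ antidiagonal (m - 1), ψ (dd m x.1) • dd m x.2

theorem dt_apply (k : ℕ) (v : Sp m) : dt m k v = if h : k < m then v ⟨k, h⟩ else 0 := by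
  unfold dt
  split_ifs <;> simp

theorem dt_dd (i j : ℕ) : dt m i (dd m j) = if i = j ∧ i < m then 1 else 0 := by
  rw [dt_apply]
  by_cases h : i < m <;> by_cases h' : i = j <;> simp [dd, h, h']

theorem sum_dt_smul_dd (v : Sp m) : ∑ k ∈ range m, dt m k v • dd m k = v := by
  ext i
  rw [Finset.sum_apply, Finset.sum_eq_single (i : ℕ)]
  · simp [dt_apply, dd]
  · intro b _ hb
    simp [dd, hb.symm]
  · intro h
    exact absurd (mem_range.2 i.2) h

theorem eps_dd (i j : ℕ) (hi : i < m) (hj : j < m) :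
    eps m (dd m i) (dd m j) = if i + j = m - 1 then 1 else 0 := by
  simp only [eps, _root_.sum_apply, ContinuousLinearMap.smulRight_apply,
    _root_.smul_apply, dt_dd, smul_eq_mul, ← ite_and, mul_ite, mul_one, mul_zero]
  split_ifs with h
  · rw [Finset.sum_eq_single (i, j)]
    · simp [hi, hj]
    · rintro ⟨a, b⟩ _ hne
      rw [if_neg]
      rintro ⟨⟨rfl, _⟩, rfl, _⟩
      exact hne rfl
    · intro h'
      exact absurd (mem_antidiagonal.2 h) h'
  · apply Finset.sum_eq_zero
    rintro ⟨a, b⟩ hab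
    rw [if_neg]
    rintro ⟨⟨rfl, _⟩, rfl, _⟩
    exact h (mem_antidiagonal.1 hab)

/-- `sharp ψ` is indeed `ε`-dual to `ψ`. -/
theorem eps_sharp (ψ : Sp m →L[ℂ] ℂ) (v : Sp m) : eps m (sharp ψ) v = ψ v := by
  have key : ∀ k < m, eps m (sharp ψ) (dd m k) = ψ (dd m k) := by
    intro k hk
    simp only [sharp, map_sum, map_smul, _root_.sum_apply,
      _root_.smul_apply, smul_eq_mul]
    rw [Finset.sum_eq_single (k, m - 1 - k)]
    · rw [eps_dd _ _ (by omega) hk, if_pos (by omega), mul_one]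
    · rintro ⟨a, b⟩ hab hne
      have hab' : a + b = m - 1 := mem_antidiagonal.1 hab
      rw [eps_dd _ _ (by omega) hk, if_neg, mul_zero]
      intro h
      apply hne
      ext
      · change a = k
        omega
      · change b = m - 1 - k
        omega
    · intro h
      exact absurd (mem_antidiagonal.2 (show k + (m - 1 - k) = m - 1 by omega)) h
  rw [← sum_dt_smul_dd v]
  simp only [map_sum, map_smul]
  exact Finset.sum_congr rfl fun k hk => by rw [key k (mem_range.1 hk)]

/-- The metric on `T^*` induced by `ε`. -/
def epsDual (φ ψ : Sp m →L[ℂ] ℂ) : ℂ := eps m (sharp φ) (sharp ψ)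

/-- The multiplication `∘` on covectors at `p`, induced by that on `T_p` through `ε`. -/
def FStructure.coMul (F : FStructure m U) (p : Sp m) (φ ψ : Sp m →L[ℂ] ℂ) : Sp m →L[ℂ] ℂ :=
  eps m (F.mul p (sharp φ) (sharp ψ))

/-- The `1`-form `β` is the inverse of the `1`-form `ψ` with respect to `∘`; the unit of `∘` on
covectors is `ε(e)`. -/
def FStructure.IsInverse (F : FStructure m U) (ψ β : OneForm m) : Prop :=
  ∀ p ∈ U, F.coMul p (ψ p) (β p) = eps m (F.e p)

/-- The `1`-form `ψ` is invertible, i.e. each covector `ψ_p` is invertible with respect to `∘`. -/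
def FStructure.IsInvertible (F : FStructure m U) (ψ : OneForm m) : Prop :=
  ∀ p ∈ U, ∃ b : Sp m →L[ℂ] ℂ, F.coMul p (ψ p) b = eps m (F.e p)

/-- `g(X, Y) = (ψ ∘ ψ)(X ∘ Y)` for all tangent vectors `X`, `Y`. -/
def FStructure.IsRootOf (F : FStructure m U) (ψ : OneForm m) (g : BilField m) : Prop :=
  ∀ p ∈ U, ∀ u v, g p u v = F.coMul p (ψ p) (ψ p) (F.mul p u v)

/-- The inductive conditions `∑_{s+t=(m-1)+k} ψ_s ψ_t = η_k` for `0 ≤ k ≤ m - 2`, where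
`ψ_s = ψ(∂_s)` (which is `0` for `s ≥ m`). -/
def FStructure.Recursion (F : FStructure m U) (ψ : OneForm m) (g : BilField m) : Prop :=
  ∀ p ∈ U, ∀ k, k + 1 < m →
    ∑ x ∈ antidiagonal (m - 1 + k), ψ p (dd m x.1) * ψ p (dd m x.2) = F.eta g k p

/-! ### The operator `γ` and the generalized Darboux–Egoroff equations -/

/-- `γ = ∑_j ∑_{i ≤ s} β_s ∂_{m-1-i}(ψ_j) ∂_{m-1+i-s} ⊗ dt^j`, where the indices range over
`0, …, m - 1` and `ψ_j = ψ(∂_j)`, `β_s = β(∂_s)`. -/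
def gam (ψ β : OneForm m) : EndField m := fun p =>
  ∑ j ∈ range m, ∑ s ∈ range m, ∑ i ∈ range (s + 1),
    (β p (dd m s) * fderiv ℂ (fun q => ψ q (dd m j)) p (dd m (m - 1 - i))) •
      (dt m j).smulRight (dd m (m - 1 + i - s))

/-- `ε`-symmetry of a field of endomorphisms on `U`. -/
def IsEpsSymm (U : Set (Sp m)) (A : EndField m) : Prop :=
  ∀ p ∈ U, ∀ u v, eps m (A p u) v = eps m u (A p v)

/-- The generalized Darboux–Egoroff equations
`[C_i, L_{∂_j} γ] - [C_j, L_{∂_i} γ] = [[C_i, γ], [C_j, γ]]`, where `C_i` is multiplication by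
`∂_i` and the brackets are commutators of endomorphisms. -/
def FStructure.DarbouxEgoroff (F : FStructure m U) (A : EndField m) : Prop :=
  ∀ p ∈ U, ∀ i < m, ∀ j < m,
    ⁅F.mul p (dd m i), lieEnd j A p⁆ - ⁅F.mul p (dd m j), lieEnd i A p⁆
      = ⁅⁅F.mul p (dd m i), A p⁆, ⁅F.mul p (dd m j), A p⁆⁆

/-- `ε(ψ, ψ)` is constant on `U`, and `γ` is `ε`-symmetric and satisfies the generalized
Darboux–Egoroff equations. -/
def FStructure.FlatCondition (F : FStructure m U) (ψ β : OneForm m) : Prop :=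
  (∃ c : ℂ, ∀ p ∈ U, epsDual (ψ p) (ψ p) = c) ∧
    IsEpsSymm U (gam ψ β) ∧ F.DarbouxEgoroff (gam ψ β)

end FMan

end

open Finset FMan

/-!
Each tangent space is the algebra `A = ℂ[z]/(z^m)`, with `∂_k = z^k`, and `ε(u, v)` is the
coefficient of `z^(m-1)` in `u ∘ v`. An invariant metric is determined by its coidentity
`η = g(e, ·)`, through `g(u, v) = η(u ∘ v)`. If `f` is the vector field `ε`-dual to `ψ`, the condition on
`ψ` says that `f ∘ f` is `ε`-dual to `η`. So `ψ` is a square root in `A` with prescribed constant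
term `r`; this is non-zero because `g` is non-degenerate, and the root is found coefficient by
coefficient (`csqrt`, `cmul_csqrt_self`) and is unique (`eq_of_cmul_self_eq`).

Multiplication by `f` is an isometry from `g` to the constant metric `ε` (`IsRoot`). The formula
for `γ` means that its `ε`-adjoint is `w ↦ D_w f` composed with division by `f`
(`IsRoot.eps_rot`), so `γ` is `ε`-symmetric exactly when `η` is closed (`IsRoot.isEpsSymm_iff`).
In that case `γ (f ∘ w) = D_w f`, and, writing `C_v` for multiplication by `v`, the connection
which in the frame `f⁻¹ ∂_i` has the connection form `v ↦ [C_v, γ]` is metric, because this form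
is `ε`-skew, and torsion free: it is the Levi-Civita connection (`IsRoot.isLeviCivita`). The
passage to that frame is a gauge transformation, which conjugates curvature (`curvature_gauge`),
and the vanishing of the curvature of `v ↦ [C_v, γ]` is the system of generalized Darboux–Egoroff
equations (`IsRoot.curv_rootConn_eq_zero_iff`).

The condition `∇ e = 0` amounts to `η` being closed and constant along `e`; once `η` is closed,
the latter says that `η_0 = ε(ψ, ψ)` is constant. Together these give `IsRoot.isFrobenius_iff`. A
local potential of `η` comes from the Poincaré lemma, and it is holomorphic because its derivative
is (`analyticAt_of_hasFDerivAt`). Finally the Euler field has derivative the identity, so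
`L_E g = E(g) + 2 g` (`lieBil_euler`).
-/

open Finset FMan

namespace FMan

/-! ### The truncated polynomial algebra -/

section TruncatedAlgebra

variable {m : ℕ} {E : Type*} [NormedAddCommGroup E] [NormedSpace ℂ E]

theorem dd_eq_zero {k : ℕ} (hk : m ≤ k) : dd m k = 0 := by
  ext i
  have := i.2
  simp only [dd, Pi.zero_apply, ite_eq_right_iff]
  omega

theorem ext_dd {A B : Sp m →L[ℂ] E} (h : ∀ k < m, A (dd m k) = B (dd m k)) : A = B := by
  ext1 v
  rw [← sum_dt_smul_dd v]
  simp only [map_sum, map_smul]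
  exact Finset.sum_congr rfl fun k hk => by rw [h k (mem_range.1 hk)]

theorem ext_dt {u v : Sp m} (h : ∀ k < m, dt m k u = dt m k v) : u = v := by
  rw [← sum_dt_smul_dd u, ← sum_dt_smul_dd v]
  exact Finset.sum_congr rfl fun k hk => by rw [h k (mem_range.1 hk)]

/-- The multiplication of the truncated polynomial algebra `ℂ[z]/(z^m)`, with `z^k` written
`dd m k`. As `u` varies, the operators `cmul m u` form a commutative algebra of endomorphisms. -/
noncomputable def cmul (m : ℕ) : Sp m →L[ℂ] Sp m →L[ℂ] Sp m :=
  ∑ i ∈ range m, ∑ j ∈ range m, (dt m i).smulRight ((dt m j).smulRight (dd m (i + j)))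

theorem cmul_dd (i j : ℕ) : cmul m (dd m i) (dd m j) = dd m (i + j) := by
  by_cases hi : i < m
  · by_cases hj : j < m
    · simp only [cmul, _root_.sum_apply, ContinuousLinearMap.smulRight_apply,
        _root_.smul_apply, dt_dd]
      rw [Finset.sum_eq_single i, Finset.sum_eq_single j]
      · simp [hi, hj]
      · intro b _ hb
        simp [hb]
      · simp [hj]
      · intro b _ hb
        simp [hb]
      · simp [hi]
    · rw [dd_eq_zero (m := m) (k := j) (by omega), dd_eq_zero (m := m) (k := i + j) (by omega),
        map_zero]
  · rw [dd_eq_zero (m := m) (k := i) (by omega), dd_eq_zero (m := m) (k := i + j) (by omega),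
      map_zero, _root_.zero_apply]

theorem cmul_comm (u v : Sp m) : cmul m u v = cmul m v u := by
  have h : cmul m = (cmul m).flip := ext_dd fun i _ => ext_dd fun j _ => by
    simp [cmul_dd, add_comm]
  exact congrArg (fun A => A u v) h

theorem cmul_assoc (u v w : Sp m) : cmul m (cmul m u v) w = cmul m u (cmul m v w) := by
  have h1 : ∀ i j, cmul m (cmul m (dd m i) (dd m j)) w = cmul m (dd m i) (cmul m (dd m j) w) := by
    intro i j
    have h : cmul m (cmul m (dd m i) (dd m j)) = (cmul m (dd m i)).comp (cmul m (dd m j)) :=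
      ext_dd fun k _ => by simp [cmul_dd, add_assoc]
    exact congrArg (fun A => A w) h
  have h2 : ∀ i, cmul m (cmul m (dd m i) v) w = cmul m (dd m i) (cmul m v w) := by
    intro i
    have h : ((cmul m).flip w).comp (cmul m (dd m i))
        = (cmul m (dd m i)).comp ((cmul m).flip w) :=
      ext_dd fun j _ => by simpa using h1 i j
    exact congrArg (fun A => A v) h
  have h : ((cmul m).flip w).comp ((cmul m).flip v) = (cmul m).flip (cmul m v w) :=
    ext_dd fun i _ => by simpa using h2 i
  exact congrArg (fun A => A u) h

theorem cmul_cmul (u v : Sp m) : cmul m (cmul m u v) = cmul m u * cmul m v :=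
  ContinuousLinearMap.ext (cmul_assoc u v)

theorem cmul_zero_dd : cmul m (dd m 0) = 1 :=
  ext_dd fun k _ => by simp [cmul_dd]

theorem dd_zero_cmul (u : Sp m) : cmul m (dd m 0) u = u :=
  congrArg (fun A => A u) cmul_zero_dd

theorem cmul_mul_comm (u v : Sp m) : cmul m u * cmul m v = cmul m v * cmul m u := by
  rw [← cmul_cmul, cmul_comm, cmul_cmul]

theorem cmul_left_comm (u v w : Sp m) : cmul m u (cmul m v w) = cmul m v (cmul m u w) :=
  congrArg (fun A => A w) (cmul_mul_comm u v)

theorem dt_cmul {k : ℕ} (hk : k < m) (u v : Sp m) :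
    dt m k (cmul m u v) = ∑ x ∈ antidiagonal k, dt m x.1 u * dt m x.2 v := by
  have h : (ContinuousLinearMap.compL ℂ _ _ _ (dt m k)).comp (cmul m)
      = ∑ x ∈ antidiagonal k, (dt m x.1).smulRight (dt m x.2) :=
    ext_dd fun i hi => ext_dd fun j hj => by
      simp only [ContinuousLinearMap.comp_apply, ContinuousLinearMap.compL_apply, cmul_dd,
        _root_.sum_apply, ContinuousLinearMap.smulRight_apply, _root_.smul_apply, dt_dd]
      by_cases hij : k = i + j
      · rw [Finset.sum_eq_single (i, j)]
        · simp [hi, hj, hij, hij ▸ hk]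
        · rintro ⟨a, b⟩ - hne
          by_cases ha : a = i
          · have hb : b ≠ j := fun hb => hne (by rw [ha, hb])
            simp [hb]
          · simp [ha]
        · simp [hij]
      · rw [if_neg (by tauto)]
        refine (Finset.sum_eq_zero ?_).symm
        rintro ⟨a, b⟩ hab
        have hab' : a + b = k := mem_antidiagonal.1 hab
        by_cases ha : a = i
        · have hb : b ≠ j := by omega
          simp [hb]
        · simp [ha]
  have := congrArg (fun A => A u v) h
  simpa [_root_.sum_apply] using this

/-- The Frobenius algebra structure: `ε(u, v)` is the top coefficient of the product. -/
theorem eps_eq_dt_cmul (hm : 0 < m) (u v : Sp m) : eps m u v = dt m (m - 1) (cmul m u v) := by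
  rw [dt_cmul (by omega)]
  simp [eps, _root_.sum_apply]

theorem eps_apply_dd {j : ℕ} (hj : j < m) (u : Sp m) : eps m u (dd m j) = dt m (m - 1 - j) u := by
  have h : (eps m).flip (dd m j) = dt m (m - 1 - j) := ext_dd fun i hi => by
    rw [ContinuousLinearMap.flip_apply, eps_dd _ _ hi hj, dt_dd]
    exact if_congr (by omega) rfl rfl
  exact congrArg (fun A => A u) h

theorem eps_comm (u v : Sp m) : eps m u v = eps m v u := by
  have h : eps m = (eps m).flip := ext_dd fun i hi => ext_dd fun j hj => by
    simp [eps_dd, hi, hj, add_comm]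
  exact congrArg (fun A => A u v) h

theorem eps_cmul_left (hm : 0 < m) (u v w : Sp m) :
    eps m (cmul m u v) w = eps m u (cmul m v w) := by
  rw [eps_eq_dt_cmul hm, eps_eq_dt_cmul hm, cmul_assoc]

theorem eps_cmul_right (hm : 0 < m) (u v w : Sp m) :
    eps m (cmul m u v) w = eps m v (cmul m u w) := by
  rw [cmul_comm, eps_cmul_left hm]

theorem eps_injective : Function.Injective (eps m) := by
  intro u v h
  refine ext_dt fun k hk => ?_
  have := congrArg (fun A => A (dd m (m - 1 - k))) h
  simp only [eps_apply_dd (show m - 1 - k < m by omega)] at this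
  rwa [show m - 1 - (m - 1 - k) = k by omega] at this

theorem eps_sharp_eq (φ : Sp m →L[ℂ] ℂ) : eps m (sharp φ) = φ :=
  ContinuousLinearMap.ext (eps_sharp φ)

theorem sharp_eps (u : Sp m) : sharp (eps m u) = u :=
  eps_injective (eps_sharp_eq _)

theorem dt_sharp {k : ℕ} (hk : k < m) (φ : Sp m →L[ℂ] ℂ) :
    dt m k (sharp φ) = φ (dd m (m - 1 - k)) := by
  rw [← eps_sharp φ, eps_apply_dd (by omega), show m - 1 - (m - 1 - k) = k by omega]

/-- Products of covectors in terms of their components. Since `sharp` reverses the order of the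
coefficients, the index of the antidiagonal is shifted by `m - 1`; the terms of the right-hand side
with an index `≥ m` vanish. -/
theorem eps_cmul_sharp_dd {k : ℕ} (hk : k < m) (φ χ : Sp m →L[ℂ] ℂ) :
    eps m (cmul m (sharp φ) (sharp χ)) (dd m k)
      = ∑ x ∈ antidiagonal (m - 1 + k), φ (dd m x.1) * χ (dd m x.2) := by
  rw [eps_apply_dd hk, dt_cmul (by omega)]
  have hinj : Set.InjOn (fun x : ℕ × ℕ => (m - 1 - x.1, m - 1 - x.2))
      (antidiagonal (m - 1 - k)) := by
    rintro ⟨a, b⟩ h1 ⟨c, d⟩ h2 h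
    have h1' : a + b = m - 1 - k := mem_antidiagonal.1 h1
    have h2' : c + d = m - 1 - k := mem_antidiagonal.1 h2
    simp only [Prod.mk.injEq] at h ⊢
    omega
  symm
  rw [← Finset.sum_subset (s₁ := (antidiagonal (m - 1 - k)).image
    fun x : ℕ × ℕ => (m - 1 - x.1, m - 1 - x.2)), Finset.sum_image hinj]
  · refine Finset.sum_congr rfl ?_
    rintro ⟨a, b⟩ hab
    have hab' : a + b = m - 1 - k := mem_antidiagonal.1 hab
    simp only
    rw [dt_sharp (by omega), dt_sharp (by omega)]
  · rintro ⟨c, d⟩ h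
    obtain ⟨⟨a, b⟩, hab, hcd⟩ := mem_image.1 h
    have hab' : a + b = m - 1 - k := mem_antidiagonal.1 hab
    simp only [Prod.mk.injEq] at hcd
    refine HasAntidiagonal.mem_antidiagonal.2 ?_
    simp only
    omega
  · rintro ⟨c, d⟩ h hn
    have h' : c + d = m - 1 + k := HasAntidiagonal.mem_antidiagonal.1 h
    have : m ≤ c ∨ m ≤ d := by
      by_contra! hlt
      refine hn (mem_image.2 ⟨(m - 1 - c, m - 1 - d), HasAntidiagonal.mem_antidiagonal.2 ?_, ?_⟩)
      · simp only
        omega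
      · ext
        · simp only
          omega
        · simp only
          omega
    rcases this with h | h <;> simp [dd_eq_zero h]

/-- An element of `ℂ[z]/(z^m)` with non-zero constant term is not a zero divisor. -/
theorem eq_zero_of_cmul_eq_zero {u w : Sp m} (hu : dt m 0 u ≠ 0) (h : cmul m u w = 0) : w = 0 := by
  refine ext_dt fun k => ?_
  induction k using Nat.strong_induction_on with
  | _ k ih =>
    intro hk
    have := dt_cmul hk u w
    rw [h, map_zero, Finset.sum_eq_single (0, k)] at this
    · rw [map_zero]
      exact (mul_eq_zero.1 this.symm).resolve_left hu
    · rintro ⟨a, b⟩ hab hne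
      have hab' : a + b = k := mem_antidiagonal.1 hab
      have hb : b < k := by
        refine lt_of_le_of_ne (by omega) fun hb => hne ?_
        ext
        · simp only
          omega
        · exact hb
      simp [ih b hb (by omega)]
    · simp

theorem exists_cmul_eq_one {u : Sp m} (hu : dt m 0 u ≠ 0) : ∃ b, cmul m u b = dd m 0 := by
  have hinj : Function.Injective (cmul m u : Sp m →ₗ[ℂ] Sp m) :=
    (injective_iff_map_eq_zero _).2 fun w hw => eq_zero_of_cmul_eq_zero hu hw
  exact LinearMap.injective_iff_surjective.1 hinj (dd m 0)

theorem isUnit_cmul {u : Sp m} (hu : dt m 0 u ≠ 0) : IsUnit (cmul m u) := by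
  obtain ⟨b, hb⟩ := exists_cmul_eq_one hu
  refine ⟨⟨cmul m u, cmul m b, ?_, ?_⟩, rfl⟩
  · rw [← cmul_cmul, hb, cmul_zero_dd]
  · rw [← cmul_cmul, cmul_comm, hb, cmul_zero_dd]

/-- The inverse in `ℂ[z]/(z^m)`, with value `0` at non-units. -/
noncomputable def cinv (u : Sp m) : Sp m := Ring.inverse (cmul m u) (dd m 0)

theorem cmul_cinv {u : Sp m} (hu : dt m 0 u ≠ 0) : cmul m u (cinv u) = dd m 0 :=
  congrArg (fun A => A (dd m 0)) (Ring.mul_inverse_cancel _ (isUnit_cmul hu))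

/-- Square roots in `ℂ[z]/(z^m)` of an element are determined by their constant term. -/
theorem eq_of_cmul_self_eq {u v : Sp m} (h0 : dt m 0 u = dt m 0 v) (hv : dt m 0 v ≠ 0)
    (h : cmul m u u = cmul m v v) : u = v := by
  refine sub_eq_zero.1 (eq_zero_of_cmul_eq_zero (u := u + v) ?_ ?_)
  · rw [map_add, h0, ← two_mul]
    exact mul_ne_zero two_ne_zero hv
  · simp only [map_add, map_sub, _root_.add_apply]
    rw [h, cmul_comm v u]
    abel

/-- The coefficients of the square root with constant term `r` of the power series with
coefficients `h`. -/
noncomputable def sqrtCoeff (r : ℂ) (h : ℕ → ℂ) : ℕ → ℂ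
  | 0 => r
  | n + 1 => (h (n + 1) - ∑ i : Fin n, sqrtCoeff r h (i + 1) * sqrtCoeff r h (n - i)) / (2 * r)
termination_by n => n
decreasing_by all_goals have := i.2; omega

theorem sum_sqrtCoeff {r : ℂ} (hr : r ≠ 0) {h : ℕ → ℂ} (h0 : r ^ 2 = h 0) (n : ℕ) :
    ∑ x ∈ antidiagonal n, sqrtCoeff r h x.1 * sqrtCoeff r h x.2 = h n := by
  cases n with
  | zero => simp [sqrtCoeff, ← h0, sq]
  | succ n =>
    rw [Finset.Nat.sum_antidiagonal_eq_sum_range_succ_mk, Finset.sum_range_succ,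
      Finset.sum_range_succ', Finset.sum_range
        (fun k => sqrtCoeff r h (k + 1) * sqrtCoeff r h (n + 1 - (k + 1)))]
    simp only [Nat.add_sub_add_right, Nat.sub_self, Nat.sub_zero]
    have e0 : sqrtCoeff r h 0 = r := by rw [sqrtCoeff]
    have e1 : sqrtCoeff r h (n + 1) * (2 * r)
        = h (n + 1) - ∑ i : Fin n, sqrtCoeff r h (i + 1) * sqrtCoeff r h (n - i) := by
      rw [sqrtCoeff, div_mul_cancel₀ _ (mul_ne_zero two_ne_zero hr)]
    rw [e0]
    linear_combination e1

/-- The square root with constant term `r` of an element of `ℂ[z]/(z^m)`. -/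
noncomputable def csqrt (r : ℂ) (h : Sp m) : Sp m :=
  ∑ k ∈ range m, sqrtCoeff r (fun n => dt m n h) k • dd m k

theorem dt_sum_smul_dd (c : ℕ → ℂ) {k : ℕ} (hk : k < m) :
    dt m k (∑ j ∈ range m, c j • dd m j) = c k := by
  simp only [map_sum, map_smul, dt_dd, smul_eq_mul]
  rw [Finset.sum_eq_single k]
  · simp [hk]
  · intro b _ hb
    simp [hb.symm]
  · simp [hk]

theorem dt_zero_csqrt (hm : 0 < m) (r : ℂ) (h : Sp m) : dt m 0 (csqrt r h) = r := by
  rw [csqrt, dt_sum_smul_dd _ hm, sqrtCoeff]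

theorem cmul_csqrt_self {r : ℂ} (hr : r ≠ 0) {h : Sp m} (h0 : r ^ 2 = dt m 0 h) :
    cmul m (csqrt r h) (csqrt r h) = h := by
  refine ext_dt fun k hk => ?_
  rw [dt_cmul hk, ← sum_sqrtCoeff (h := fun n => dt m n h) hr h0 k]
  refine Finset.sum_congr rfl ?_
  rintro ⟨a, b⟩ hab
  have hab' : a + b = k := mem_antidiagonal.1 hab
  rw [csqrt, dt_sum_smul_dd _ (by omega), dt_sum_smul_dd _ (by omega)]

end TruncatedAlgebra

/-! ### Holomorphic square roots and inverses -/

section Analyticity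

variable {m : ℕ} {V : Type*} [NormedAddCommGroup V] [NormedSpace ℂ V] {s : Set V}

theorem analyticOnNhd_csqrt {r : V → ℂ} {h : V → Sp m} (hr : AnalyticOnNhd ℂ r s)
    (hh : AnalyticOnNhd ℂ h s) (hr0 : ∀ p ∈ s, r p ≠ 0) :
    AnalyticOnNhd ℂ (fun p => csqrt (r p) (h p)) s := by
  have key : ∀ k, AnalyticOnNhd ℂ (fun p => sqrtCoeff (r p) (fun n => dt m n (h p)) k) s := by
    intro k
    induction k using Nat.strong_induction_on with
    | _ k ih =>
      cases k with
      | zero => simpa only [sqrtCoeff] using hr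
      | succ n =>
        have e : (fun p => sqrtCoeff (r p) (fun n => dt m n (h p)) (n + 1)) = fun p =>
            (dt m (n + 1) (h p) - ∑ i : Fin n, sqrtCoeff (r p) (fun n => dt m n (h p)) (i + 1)
              * sqrtCoeff (r p) (fun n => dt m n (h p)) (n - i)) / (2 * r p) :=
          funext fun p => by rw [sqrtCoeff]
        rw [e]
        refine AnalyticOnNhd.div (.sub ((dt m (n + 1)).comp_analyticOnNhd hh) ?_)
          (.mul analyticOnNhd_const hr) fun p hp => mul_ne_zero two_ne_zero (hr0 p hp)
        refine Finset.analyticOnNhd_fun_sum _ fun i _ => ?_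
        have := i.2
        exact (ih _ (by omega)).mul (ih _ (by omega))
  exact Finset.analyticOnNhd_fun_sum _ fun k _ => (key k).smul analyticOnNhd_const

theorem analyticOnNhd_cinv {u : V → Sp m} (hu : AnalyticOnNhd ℂ u s)
    (hu0 : ∀ p ∈ s, dt m 0 (u p) ≠ 0) : AnalyticOnNhd ℂ (fun p => cinv (u p)) s := by
  intro p hp
  have h1 : AnalyticAt ℂ (fun q => Ring.inverse (cmul m (u q))) p :=
    ((analyticOnNhd_inverse (𝕜 := ℂ)) _ (isUnit_cmul (hu0 p hp))).comp
      (f := fun q => cmul m (u q)) (((cmul m).analyticAt _).comp (hu p hp))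
  exact ((ContinuousLinearMap.apply ℂ (Sp m) (dd m 0)).analyticAt _).comp h1

end Analyticity

/-! ### Operator-valued functions -/

section OperatorFields

variable {V X Y Z : Type*} [NormedAddCommGroup V] [NormedSpace ℂ V]
  [NormedAddCommGroup X] [NormedSpace ℂ X] [NormedAddCommGroup Y] [NormedSpace ℂ Y]
  [NormedAddCommGroup Z] [NormedSpace ℂ Z] {s : Set V} {A : V → Y →L[ℂ] Z}

theorem analyticOnNhd_clm_comp {B : V → X →L[ℂ] Y}
    (hA : AnalyticOnNhd ℂ A s) (hB : AnalyticOnNhd ℂ B s) :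
    AnalyticOnNhd ℂ (fun p => (A p).comp (B p)) s := fun p hp =>
  ((ContinuousLinearMap.compL ℂ X Y Z).analyticAt_bilinear (A p, B p)).comp
    (f := fun p => (A p, B p)) ((hA p hp).prod (hB p hp))

theorem analyticOnNhd_compL (hA : AnalyticOnNhd ℂ A s) :
    AnalyticOnNhd ℂ (fun p => ContinuousLinearMap.compL ℂ X Y Z (A p)) s := by
  change AnalyticOnNhd ℂ (⇑(ContinuousLinearMap.compL ℂ X Y Z) ∘ A) s
  apply ContinuousLinearMap.comp_analyticOnNhd
  exact hA

theorem analyticOnNhd_compL_flip (hA : AnalyticOnNhd ℂ A s) :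
    AnalyticOnNhd ℂ (fun p => (ContinuousLinearMap.compL ℂ Y Z X).flip (A p)) s := by
  change AnalyticOnNhd ℂ (⇑(ContinuousLinearMap.compL ℂ Y Z X).flip ∘ A) s
  apply ContinuousLinearMap.comp_analyticOnNhd
  exact hA

theorem analyticOnNhd_clm_apply_const (hA : AnalyticOnNhd ℂ A s) (v : Y) :
    AnalyticOnNhd ℂ (fun p => A p v) s :=
  (ContinuousLinearMap.apply ℂ Z v).comp_analyticOnNhd hA

theorem differentiableAt_clm_apply_const {p : V} (hA : DifferentiableAt ℂ A p) (v : Y) :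
    DifferentiableAt ℂ (fun q => A q v) p :=
  hA.clm_apply (differentiableAt_const v)

theorem fderiv_clm_apply_const {p : V} (hA : DifferentiableAt ℂ A p) (u : V) (v : Y) :
    fderiv ℂ (fun q => A q v) p u = fderiv ℂ A p u v :=
  congrArg (fun B => B u)
    ((ContinuousLinearMap.apply ℂ Z v).hasFDerivAt.comp p hA.hasFDerivAt).fderiv

end OperatorFields

/-! ### Holomorphic primitives -/

section Primitives

variable {V G : Type*} [NormedAddCommGroup V] [NormedSpace ℂ V]
  [NormedAddCommGroup G] [NormedSpace ℂ G] [CompleteSpace G]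

/-- Only the directional derivatives at the points of the complex line through `q` and `q + x` are
needed; the set of parameters of that line in `W` is convex. -/
theorem eq_of_fderiv_eq_zero_on_line {V G : Type*} [NormedAddCommGroup V]
    [NormedSpace ℂ V] [NormedAddCommGroup G] [NormedSpace ℂ G] {W : Set V} (hW : IsOpen W)
    (hc : Convex ℝ W) {φ : V → G} (hφ : ∀ q ∈ W, DifferentiableAt ℂ φ q) {q x : V}
    (h : ∀ s : ℂ, q + s • x ∈ W → fderiv ℂ φ (q + s • x) x = 0) (hq : q ∈ W) (hqx : q + x ∈ W) :
    φ (q + x) = φ q := by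
  let S : Set ℂ := {s | q + s • x ∈ W}
  have hSo : IsOpen S := hW.preimage (by fun_prop)
  have hSc : Convex ℝ S := (hc.translate_preimage_right q).linear_preimage
    ((LinearMap.toSpanSingleton ℂ V x).restrictScalars ℝ)
  have hd : ∀ s ∈ S, HasDerivAt (fun s : ℂ => φ (q + s • x)) 0 s := by
    intro s hs
    have hl : HasDerivAt (fun s : ℂ => q + s • x) x s := by
      simpa using ((hasDerivAt_id s).smul_const x).const_add q
    have := (hφ _ hs).hasFDerivAt.comp_hasDerivAt s hl
    rwa [h s hs] at this
  have := hSo.is_const_of_deriv_eq_zero hSc.isPreconnected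
    (fun s hs => (hd s hs).differentiableAt.differentiableWithinAt)
    (fun s hs => (hd s hs).deriv) (x := 1) (y := 0) (by simpa [S] using hqx) (by simpa [S] using hq)
  simpa using this

/-- A function with analytic Fréchet derivative is analytic: if `∑ Pₙ` is the power series of the
derivative, then `∑ Pₙ / (n + 1)` converges, and it has the same derivative along rays. -/
theorem analyticAt_of_hasFDerivAt {f : V → G} {ω : V → V →L[ℂ] G} {p : V}
    (hω : AnalyticAt ℂ ω p) (hf : ∀ᶠ q in nhds p, HasFDerivAt f (ω q) q) : AnalyticAt ℂ f p := by
  obtain ⟨P, r, hP⟩ := hω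
  let Q : FormalMultilinearSeries ℂ V G := fun n => (n : ℂ)⁻¹ • P.unshift 0 n
  have hQr : r ≤ Q.radius := by
    refine hP.r_le.trans ?_
    rw [← P.radius_unshift 0]
    refine ENNReal.le_of_forall_nnreal_lt fun t ht => ?_
    refine Q.le_radius_of_isBigO (.trans (.of_bound 1 (.of_forall fun n => ?_))
      ((P.unshift 0).isLittleO_one_of_lt_radius ht).isBigO)
    rw [one_mul, norm_mul, norm_mul, norm_norm, norm_norm]
    refine mul_le_mul_of_nonneg_right ?_ (norm_nonneg _)
    rw [norm_smul, norm_inv, Complex.norm_natCast]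
    refine mul_le_of_le_one_left (norm_nonneg _) ?_
    rcases n.eq_zero_or_pos with rfl | hn
    · simp
    · exact inv_le_one_of_one_le₀ (by exact_mod_cast hn)
  have hK := Q.hasFPowerSeriesOnBall (hP.r_pos.trans_le hQr)
  obtain ⟨ε, hε, hε'⟩ := Metric.eventually_nhds_iff_ball.1
    (hf.and (Metric.eball_mem_nhds p hP.r_pos))
  have hball : ∀ y : V, p + y ∈ Metric.ball p ε → y ∈ Metric.eball (0 : V) r := by
    intro y hy
    simpa [edist_eq_enorm_sub] using (hε' _ hy).2
  -- the radial derivatives of `f` and of the integrated series agree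
  have hrad : ∀ x : V, ∀ s : ℂ, s • x ∈ Metric.eball (0 : V) r →
      fderiv ℂ Q.sum (s • x) x = ω (p + s • x) x := by
    intro x s hs
    have h1 := (ContinuousLinearMap.apply ℂ G x).hasSum
      (hK.fderiv.hasSum (Metric.eball_subset_eball hQr hs))
    have h2 := (ContinuousLinearMap.apply ℂ G x).hasSum (hP.hasSum hs)
    rw [zero_add] at h1
    refine h1.unique ?_
    convert! h2 using 1
    ext n
    have e1 : Q.derivSeries n (fun _ => s • x) = s ^ n • Q.derivSeries n (fun _ => x) := by
      simpa using (Q.derivSeries n).map_smul_univ (fun _ => s) (fun _ => x)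
    have e2 : P n (fun _ => s • x) = s ^ n • P n (fun _ => x) := by
      simpa using (P n).map_smul_univ (fun _ => s) (fun _ => x)
    have e3 : Q (n + 1) (fun _ => x) = ((n + 1 : ℕ) : ℂ)⁻¹ • P n (fun _ => x) x := rfl
    have hn : ((n + 1 : ℕ) : ℂ) ≠ 0 := Nat.cast_ne_zero.2 n.succ_ne_zero
    simp only [ContinuousLinearMap.apply_apply]
    rw [e1, e2, _root_.smul_apply, _root_.smul_apply, Q.derivSeries_apply_diag, e3,
      ← Nat.cast_smul_eq_nsmul ℂ, smul_smul ((n + 1 : ℕ) : ℂ), mul_inv_cancel₀ hn, one_smul]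
  have heq : ∀ x : V, p + x ∈ Metric.ball p ε → f (p + x) = f p + Q.sum x - Q.sum 0 := by
    intro x hx
    have hd : ∀ y ∈ Metric.ball (0 : V) ε, HasFDerivAt (fun y => f (p + y) - Q.sum y)
        (ω (p + y) - fderiv ℂ Q.sum y) y := by
      intro y hy
      have hy' : p + y ∈ Metric.ball p ε := by simpa using hy
      have hyQ := Metric.eball_subset_eball hQr (hball y hy')
      have hf' : HasFDerivAt (fun y => f (p + y)) (ω (p + y)) y :=
        (hε' _ hy').1.comp y ((hasFDerivAt_id y).const_add p)
      exact hf'.sub ((hK.differentiableOn _ hyQ).differentiableAt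
        (Metric.isOpen_eball.mem_nhds hyQ)).hasFDerivAt
    have := eq_of_fderiv_eq_zero_on_line Metric.isOpen_ball (convex_ball (0 : V) ε)
      (fun y hy => (hd y hy).differentiableAt) (q := 0) (x := x)
      (fun s hs => by
        rw [zero_add] at hs ⊢
        rw [(hd _ hs).fderiv, _root_.sub_apply, hrad x s (hball _ (by simpa using hs)), sub_self])
      (by simpa using hε) (by simpa using hx)
    simp only [zero_add, add_zero] at this
    rw [sub_eq_sub_iff_add_eq_add] at this
    rw [eq_sub_iff_add_eq, this]
  have hKa : AnalyticAt ℂ (fun q => f p + Q.sum (q - p) - Q.sum 0) p := by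
    have h0 : AnalyticAt ℂ Q.sum (p - p) := by
      rw [sub_self]
      exact hK.analyticAt
    exact (analyticAt_const.add (h0.comp (f := fun q => q - p)
      (analyticAt_id.sub analyticAt_const))).sub analyticAt_const
  refine hKa.congr ?_
  filter_upwards [Metric.ball_mem_nhds p hε] with q hq
  have := heq (q - p) (by simpa using hq)
  simpa using this.symm

/-- The holomorphic Poincaré lemma for `1`-forms on a convex open set. -/
theorem exists_analytic_potential {ω : V → V →L[ℂ] G} {W : Set V} (hW : IsOpen W)
    (hc : Convex ℝ W) (hω : AnalyticOnNhd ℂ ω W)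
    (hcl : ∀ q ∈ W, ∀ u v, fderiv ℂ ω q u v = fderiv ℂ ω q v u) :
    ∃ H : V → G, AnalyticOnNhd ℂ H W ∧ ∀ q ∈ W, HasFDerivAt H (ω q) q := by
  obtain ⟨H, hH⟩ := hc.exists_forall_hasFDerivAt_of_fderiv_symmetric hW
    (ω := ω) (fun q hq => ((hω q hq).differentiableAt.restrictScalars ℝ).differentiableWithinAt)
    (fun q hq u v => by
      rw [(hω q hq).differentiableAt.fderiv_restrictScalars ℝ]
      exact hcl q hq u v)
  refine ⟨H, fun q hq => analyticAt_of_hasFDerivAt (hω q hq) ?_, hH⟩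
  filter_upwards [hW.mem_nhds hq] with q hq using hH q hq

end Primitives

/-! ### Gauge transformations -/

section Gauge

variable {V 𝔸 : Type*} [NormedAddCommGroup V] [NormedSpace ℂ V] [NormedRing 𝔸] [NormedAlgebra ℂ 𝔸]
  [CompleteSpace 𝔸]

/-- The gauge transformation `Γ = Φ⁻¹ (dΦ + ω Φ)` conjugates the curvature `dω + ω ∧ ω` of the
connection form `ω` by `Φ`. -/
theorem curvature_gauge {Φ B : V → 𝔸} {ω : V → V → 𝔸} {p : V}
    (hΦ : AnalyticAt ℂ Φ p) (hB : DifferentiableAt ℂ B p)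
    (hω : ∀ v, DifferentiableAt ℂ (fun q => ω q v) p)
    (hBΦ : ∀ᶠ q in nhds p, B q * Φ q = 1) (hΦB : Φ p * B p = 1) (u v : V)
    {Γ : V → V → 𝔸} (hΓ : ∀ q v, Γ q v = B q * (fderiv ℂ Φ q v + ω q v * Φ q)) :
    fderiv ℂ (fun q => Γ q v) p u - fderiv ℂ (fun q => Γ q u) p v + Γ p u * Γ p v - Γ p v * Γ p u
      = B p * (fderiv ℂ (fun q => ω q v) p u - fderiv ℂ (fun q => ω q u) p v
          + ω p u * ω p v - ω p v * ω p u) * Φ p := by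
  have hD : ∀ v, HasFDerivAt (fun q => fderiv ℂ Φ q v)
      ((ContinuousLinearMap.apply ℂ 𝔸 v).comp (fderiv ℂ (fderiv ℂ Φ) p)) p := fun v =>
    (ContinuousLinearMap.apply ℂ 𝔸 v).hasFDerivAt.comp p
      hΦ.fderiv.differentiableAt.hasFDerivAt
  have hmul : ∀ {x y : V → 𝔸}, DifferentiableAt ℂ x p → DifferentiableAt ℂ y p → ∀ u,
      fderiv ℂ (fun q => x q * y q) p u = fderiv ℂ x p u * y p + x p * fderiv ℂ y p u := by
    intro x y hx hy u
    have h : fderiv ℂ (fun q => x q * y q) p = _ := (hx.hasFDerivAt.mul' hy.hasFDerivAt).fderiv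
    rw [h, add_comm]
    rfl
  have hΓ' : ∀ u v, fderiv ℂ (fun q => Γ q v) p u
      = fderiv ℂ B p u * (fderiv ℂ Φ p v + ω p v * Φ p)
        + B p * (fderiv ℂ (fderiv ℂ Φ) p u v
          + (fderiv ℂ (fun q => ω q v) p u * Φ p + ω p v * fderiv ℂ Φ p u)) := by
    intro u v
    have h1 : fderiv ℂ (fun q => fderiv ℂ Φ q v + ω q v * Φ q) p u
        = fderiv ℂ (fderiv ℂ Φ) p u v
          + (fderiv ℂ (fun q => ω q v) p u * Φ p + ω p v * fderiv ℂ Φ p u) := by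
      rw [← hmul (hω v) hΦ.differentiableAt, fderiv_fun_add (hD v).differentiableAt
        ((hω v).fun_mul hΦ.differentiableAt), (hD v).fderiv]
      rfl
    rw [funext fun q => hΓ q v, hmul hB ((hD v).differentiableAt.fun_add
      ((hω v).fun_mul hΦ.differentiableAt)), h1]
  have hDB : ∀ u, fderiv ℂ B p u = - (B p * fderiv ℂ Φ p u * B p) := by
    intro u
    have h1 : fderiv ℂ (fun q => B q * Φ q) p u = 0 := by
      have : (fun q => B q * Φ q) =ᶠ[nhds p] fun _ => 1 := hBΦ
      rw [this.fderiv_eq]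
      simp
    have h2 : fderiv ℂ B p u * Φ p + B p * fderiv ℂ Φ p u = 0 := by
      rw [← hmul hB hΦ.differentiableAt, h1]
    calc fderiv ℂ B p u = fderiv ℂ B p u * (Φ p * B p) := by rw [hΦB, mul_one]
      _ = (fderiv ℂ B p u * Φ p + B p * fderiv ℂ Φ p u) * B p - B p * fderiv ℂ Φ p u * B p := by
        noncomm_ring
      _ = _ := by rw [h2]; noncomm_ring
  have hsymm : fderiv ℂ (fderiv ℂ Φ) p u v = fderiv ℂ (fderiv ℂ Φ) p v u :=
    (ContDiffAt.isSymmSndFDerivAt_of_omega hΦ.contDiffAt) u v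
  have hmid : ∀ x y : 𝔸, B p * x * Φ p * (B p * y) = B p * x * y := by
    intro x y
    rw [mul_assoc, ← mul_assoc (Φ p), hΦB, one_mul]
  have hprod : ∀ u v, Γ p u * Γ p v = B p * fderiv ℂ Φ p u * B p * (fderiv ℂ Φ p v + ω p v * Φ p)
      + B p * ω p u * (fderiv ℂ Φ p v + ω p v * Φ p) := by
    intro u v
    rw [hΓ, hΓ, ← hmid (ω p u)]
    noncomm_ring
  rw [hΓ', hΓ', hDB, hDB, hprod, hprod, hsymm]
  noncomm_ring

end Gauge

/-! ### The operator `γ` -/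

section Gamma

variable {m : ℕ} {U : Set (Sp m)}

/-- The `ε`-adjoint of `γ` sends `w` to the derivative of `ψ` along `β ∘ w`. -/
theorem eps_gam {ψ : OneForm m} (β : OneForm m) {p : Sp m} (hψ : DifferentiableAt ℂ ψ p)
    (v w : Sp m) :
    eps m (gam ψ β p v) w = fderiv ℂ ψ p (cmul m (sharp (β p)) w) v := by
  have hD : ∀ j x, fderiv ℂ (fun q => ψ q (dd m j)) p x = fderiv ℂ ψ p x (dd m j) := fun j x =>
    fderiv_clm_apply_const hψ x (dd m j)
  suffices h : eps m (gam ψ β p v) = ((fderiv ℂ ψ p).flip v).comp (cmul m (sharp (β p))) from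
    congrArg (fun A => A w) h
  refine ext_dd fun k hk => ?_
  have hβ : sharp (β p) = ∑ s ∈ range m, β p (dd m s) • dd m (m - 1 - s) := by
    rw [sharp, Finset.Nat.sum_antidiagonal_eq_sum_range_succ_mk]
    exact Finset.sum_congr (by congr 1; omega) fun _ _ => rfl
  have hs : ∀ s ∈ range m, ∀ j, ∑ i ∈ range (s + 1),
      (β p (dd m s) * fderiv ℂ ψ p (dd m (m - 1 - i)) (dd m j)) *
        (dt m j v * eps m (dd m (m - 1 + i - s)) (dd m k))
      = β p (dd m s) * (dt m j v * fderiv ℂ ψ p (dd m (m - 1 - s + k)) (dd m j)) := by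
    intro s hs j
    have hs' := mem_range.1 hs
    by_cases hks : k ≤ s
    · rw [Finset.sum_eq_single (s - k)]
      · rw [eps_dd _ _ (by omega) hk, if_pos (by omega),
          show m - 1 - (s - k) = m - 1 - s + k by omega]
        ring
      · intro i hi hne
        have := mem_range.1 hi
        rw [eps_dd _ _ (by omega) hk, if_neg (by omega), mul_zero, mul_zero]
      · intro h
        exact absurd (mem_range.2 (by omega)) h
    · rw [dd_eq_zero (m := m) (k := m - 1 - s + k) (by omega), map_zero, _root_.zero_apply,
        mul_zero, mul_zero]
      refine Finset.sum_eq_zero fun i hi => ?_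
      have := mem_range.1 hi
      rw [eps_dd _ _ (by omega) hk, if_neg (by omega), mul_zero, mul_zero]
  have hv : ∀ φ : Sp m →L[ℂ] ℂ, ∑ j ∈ range m, dt m j v * φ (dd m j) = φ v := by
    intro φ
    conv_rhs => rw [← sum_dt_smul_dd v]
    simp
  simp only [gam, _root_.sum_apply, _root_.smul_apply, ContinuousLinearMap.smulRight_apply,
    map_sum, map_smul, hD, smul_eq_mul, ContinuousLinearMap.comp_apply,
    ContinuousLinearMap.flip_apply, hβ, cmul_dd]
  rw [Finset.sum_comm]
  refine Finset.sum_congr rfl fun s hs' => ?_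
  rw [← hv, Finset.mul_sum]
  exact Finset.sum_congr rfl fun j _ => hs s hs' j

theorem analyticOnNhd_gam {ψ β : OneForm m} (hψ : AnalyticOnNhd ℂ ψ U)
    (hβ : AnalyticOnNhd ℂ β U) : AnalyticOnNhd ℂ (gam ψ β) U := by
  refine Finset.analyticOnNhd_fun_sum _ fun j _ => Finset.analyticOnNhd_fun_sum _ fun s _ =>
    Finset.analyticOnNhd_fun_sum _ fun i _ =>
      ((analyticOnNhd_clm_apply_const hβ _).mul ?_).smul analyticOnNhd_const
  exact analyticOnNhd_clm_apply_const (analyticOnNhd_clm_apply_const hψ _).fderiv _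

end Gamma

/-! ### Square roots of invariant metrics -/

section Root

variable {m : ℕ} {U : Set (Sp m)}

/-- The vector field `f` is a square root of the multiplication invariant metric `g` in the
algebra `ℂ[z]/(z^m)`, and `b` is its inverse: multiplication by `f` is at each point an isometry
from `g` to the constant metric `ε`. -/
structure IsRoot (U : Set (Sp m)) (g : BilField m) (f b : VF m) : Prop where
  isOpen : IsOpen U
  holo : AnalyticOnNhd ℂ f U
  inv_holo : AnalyticOnNhd ℂ b U
  mul_inv : ∀ p ∈ U, cmul m (f p) (b p) = dd m 0
  metric_eq : ∀ p ∈ U, ∀ u v, g p u v = eps m (cmul m (f p) u) (cmul m (f p) v)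

/-- The endomorphism `γ` attached to the `1`-forms `ε(f)` and `ε(b)`. -/
noncomputable abbrev rot (f b : VF m) : EndField m :=
  gam (fun p => eps m (f p)) (fun p => eps m (b p))

/-- The connection `Γ_v = f⁻¹ (D_v f + [C_v, γ] f)`: the image of the connection form
`v ↦ [C_v, γ]` under the gauge transformation given by multiplication by `f`. -/
noncomputable def rootConn (f b : VF m) : MulField m := fun p =>
  let M := ContinuousLinearMap.compL ℂ (Sp m) (Sp m) (Sp m)
  (M (cmul m (b p))).comp ((cmul m).comp (fderiv ℂ f p) +
    (M.flip (cmul m (f p))).comp ((M.flip (rot f b p) - M (rot f b p)).comp (cmul m)))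

variable {g : BilField m} {f b : VF m}

namespace IsRoot

section
variable (h : IsRoot U g f b) {p : Sp m} (hp : p ∈ U)
include h hp

theorem cmul_root_inv (v : Sp m) : cmul m (f p) (cmul m (b p) v) = v := by
  rw [← cmul_assoc, h.mul_inv p hp, dd_zero_cmul]

theorem cmul_inv_root (v : Sp m) : cmul m (b p) (cmul m (f p) v) = v := by
  rw [cmul_left_comm, h.cmul_root_inv hp]

/-- The `ε`-adjoint of `γ` is `w ↦ D_{b ∘ w} f`. -/
theorem eps_rot (v w : Sp m) :
    eps m (rot f b p v) w = eps m (fderiv ℂ f p (cmul m (b p) w)) v := by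
  have hψ : HasFDerivAt (fun q => eps m (f q)) ((eps m).comp (fderiv ℂ f p)) p :=
    (eps m).hasFDerivAt.comp p (h.holo p hp).differentiableAt.hasFDerivAt
  rw [rot, eps_gam _ hψ.differentiableAt, hψ.fderiv, sharp_eps]
  rfl

theorem fderiv_metric (hm : 0 < m) (w u v : Sp m) :
    fderiv ℂ (fun q => g q u v) p w
      = 2 * eps m (cmul m (f p) (fderiv ℂ f p w)) (cmul m u v) := by
  have heq : (fun q => g q u v) =ᶠ[nhds p] fun q => eps m (cmul m (f q) (f q)) (cmul m u v) := by
    filter_upwards [h.isOpen.mem_nhds hp] with q hq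
    rw [h.metric_eq q hq, eps_cmul_left hm, eps_cmul_left hm, cmul_left_comm u]
  have hf := (h.holo p hp).differentiableAt.hasFDerivAt
  have hd := ((ContinuousLinearMap.apply ℂ ℂ (cmul m u v)).comp (eps m)).hasFDerivAt.comp p
    ((cmul m).hasFDerivAt_of_bilinear hf hf)
  rw [heq.fderiv_eq]
  refine (congrArg (fun A => A w) hd.fderiv).trans ?_
  change eps m (cmul m (f p) (fderiv ℂ f p w) + cmul m (fderiv ℂ f p w) (f p)) (cmul m u v) = _
  rw [cmul_comm (fderiv ℂ f p w), ← two_smul ℂ, map_smul]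
  rfl

/-- If `γ` is `ε`-symmetric, then it sends `f ∘ w` to the derivative of `f` along `w`. -/
theorem rot_root (hs : IsEpsSymm U (rot f b)) (w : Sp m) :
    rot f b p (cmul m (f p) w) = fderiv ℂ f p w := by
  refine eps_injective (ContinuousLinearMap.ext fun v => ?_)
  rw [hs p hp, eps_comm, h.eps_rot hp, h.cmul_inv_root hp]

end

variable (h : IsRoot U g f b)
include h

/-- `γ` is `ε`-symmetric if and only if the coidentity `g(e, ·)` is closed. -/
theorem isEpsSymm_iff (hm : 0 < m) : IsEpsSymm U (rot f b) ↔
    ∀ p ∈ U, ∀ u v, fderiv ℂ (fun q => g q (dd m 0) v) p u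
      = fderiv ℂ (fun q => g q (dd m 0) u) p v := by
  have key : ∀ p ∈ U, ∀ u v, fderiv ℂ (fun q => g q (dd m 0) v) p u
      = 2 * eps m (rot f b p (cmul m (f p) v)) (cmul m (f p) u) := by
    intro p hp u v
    rw [h.fderiv_metric hp hm, dd_zero_cmul, h.eps_rot hp, h.cmul_inv_root hp, eps_cmul_right hm]
  constructor
  · intro hs p hp u v
    rw [key p hp, key p hp, hs p hp, eps_comm]
  · intro hc p hp u v
    have e := hc p hp (cmul m (b p) v) (cmul m (b p) u)
    rw [key p hp, key p hp, h.cmul_root_inv hp, h.cmul_root_inv hp] at e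
    rw [eps_comm u]
    exact mul_left_cancel₀ two_ne_zero e

theorem analyticOnNhd_rot : AnalyticOnNhd ℂ (rot f b) U :=
  analyticOnNhd_gam ((eps m).comp_analyticOnNhd h.holo) ((eps m).comp_analyticOnNhd h.inv_holo)

theorem analyticOnNhd_rootConn : AnalyticOnNhd ℂ (rootConn f b) U := by
  have hf := (cmul m).comp_analyticOnNhd h.holo
  have hb := (cmul m).comp_analyticOnNhd h.inv_holo
  have hr := h.analyticOnNhd_rot
  exact analyticOnNhd_clm_comp (analyticOnNhd_compL hb) (.add
    (analyticOnNhd_clm_comp analyticOnNhd_const h.holo.fderiv)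
    (analyticOnNhd_clm_comp (analyticOnNhd_compL_flip hf) (analyticOnNhd_clm_comp
      (.sub (analyticOnNhd_compL_flip hr) (analyticOnNhd_compL hr)) analyticOnNhd_const)))

theorem rootConn_apply_apply (hs : IsEpsSymm U (rot f b)) {p : Sp m} (hp : p ∈ U) (u v : Sp m) :
    rootConn f b p u v = cmul m (b p) (cmul m (fderiv ℂ f p u) v + cmul m (fderiv ℂ f p v) u
      - rot f b p (cmul m (f p) (cmul m u v))) := by
  rw [cmul_comm (fderiv ℂ f p v), ← h.rot_root hp hs v, cmul_left_comm (f p) u v]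
  rw [add_sub_assoc]
  rfl

/-- If the coidentity is closed, then `rootConn f b` is the Levi-Civita connection. It is metric
because `[C_v, γ]` is `ε`-skew, and it is torsion free because `γ (f ∘ w) = D_w f`. -/
theorem isLeviCivita (hm : 0 < m) (hs : IsEpsSymm U (rot f b)) :
    IsLeviCivita U g (rootConn f b) where
  holo := h.analyticOnNhd_rootConn
  torsion_free p hp u v := by
    rw [h.rootConn_apply_apply hs hp, h.rootConn_apply_apply hs hp, cmul_comm u v,
      add_comm (cmul m (fderiv ℂ f p u) v)]
  metric p hp w u v := by
    have hx : ∀ u, cmul m (f p) (rootConn f b p w u) = cmul m (fderiv ℂ f p w) u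
        + (cmul m w (rot f b p (cmul m (f p) u)) - rot f b p (cmul m w (cmul m (f p) u))) := by
      intro u
      exact h.cmul_root_inv hp _
    have hskew : ∀ x y, eps m (cmul m w (rot f b p x) - rot f b p (cmul m w x)) y
        = - eps m x (cmul m w (rot f b p y) - rot f b p (cmul m w y)) := by
      intro x y
      rw [map_sub, map_sub, _root_.sub_apply, eps_cmul_right hm, hs p hp x, hs p hp (cmul m w x),
        eps_cmul_right hm]
      ring
    rw [h.metric_eq p hp, h.metric_eq p hp, h.fderiv_metric hp hm, hx, hx, map_add, map_add,
      _root_.add_apply, hskew, cmul_comm (fderiv ℂ f p w) v]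
    have e1 : eps m (cmul m (fderiv ℂ f p w) u) (cmul m (f p) v)
        = eps m (cmul m (f p) (fderiv ℂ f p w)) (cmul m u v) := by
      rw [eps_cmul_left hm, eps_cmul_right hm, cmul_left_comm]
    have e2 : eps m (cmul m (f p) u) (cmul m v (fderiv ℂ f p w))
        = eps m (cmul m (f p) (fderiv ℂ f p w)) (cmul m u v) := by
      rw [eps_comm, cmul_comm v, eps_cmul_left hm, eps_cmul_right hm, cmul_left_comm v, cmul_comm v]
    rw [e1, e2]
    ring

/-- The curvature of `rootConn f b` is conjugate to that of the connection form `v ↦ [C_v, γ]`. -/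
theorem curv_rootConn {p : Sp m} (hp : p ∈ U) (u v w : Sp m) :
    curv (rootConn f b) p u v w = cmul m (b p) ((⁅cmul m v, fderiv ℂ (rot f b) p u⁆
      - ⁅cmul m u, fderiv ℂ (rot f b) p v⁆ + ⁅⁅cmul m u, rot f b p⁆, ⁅cmul m v, rot f b p⁆⁆)
        (cmul m (f p) w)) := by
  have hγ := (h.analyticOnNhd_rot p hp).differentiableAt
  have hconn := (h.analyticOnNhd_rootConn p hp).differentiableAt
  let M := ContinuousLinearMap.compL ℂ (Sp m) (Sp m) (Sp m)
  have hω : ∀ v, HasFDerivAt (fun q => ⁅cmul m v, rot f b q⁆)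
      ((M (cmul m v) - M.flip (cmul m v)).comp (fderiv ℂ (rot f b) p)) p := fun v =>
    (M (cmul m v) - M.flip (cmul m v)).hasFDerivAt.comp p hγ.hasFDerivAt
  have hω' : ∀ u v, fderiv ℂ (fun q => ⁅cmul m v, rot f b q⁆) p u
      = ⁅cmul m v, fderiv ℂ (rot f b) p u⁆ := fun u v => by
    rw [(hω v).fderiv]
    rfl
  have hΦ : ∀ q ∈ U, ∀ v, fderiv ℂ (fun q => cmul m (f q)) q v = cmul m (fderiv ℂ f q v) := by
    intro q hq v
    exact congrArg (fun A => A v) ((cmul m).hasFDerivAt.comp q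
      (h.holo q hq).differentiableAt.hasFDerivAt).fderiv
  have hc := curvature_gauge (Φ := fun q => cmul m (f q)) (B := fun q => cmul m (b q))
    (ω := fun q v => ⁅cmul m v, rot f b q⁆) ((cmul m).comp_analyticOnNhd h.holo p hp)
    ((cmul m).comp_analyticOnNhd h.inv_holo p hp).differentiableAt
    (fun v => (hω v).differentiableAt)
    (by
      filter_upwards [h.isOpen.mem_nhds hp] with q hq
      rw [← cmul_cmul, cmul_comm, h.mul_inv q hq, cmul_zero_dd])
    (by rw [← cmul_cmul, h.mul_inv p hp, cmul_zero_dd]) u v (fun q v => rfl)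
  have hΓ : ∀ v, (fun q => rootConn f b q v) =ᶠ[nhds p] fun q => cmul m (b q) *
      (fderiv ℂ (fun q => cmul m (f q)) q v + ⁅cmul m v, rot f b q⁆ * cmul m (f q)) := by
    intro v
    filter_upwards [h.isOpen.mem_nhds hp] with q hq
    rw [hΦ q hq]
    rfl
  have hd : ∀ v w u, fderiv ℂ (fun q => rootConn f b q v w) p u
      = fderiv ℂ (fun q => rootConn f b q v) p u w := by
    intro v w u
    rw [fderiv_clm_apply_const (differentiableAt_clm_apply_const hconn v)]
  simp only [← (hΓ _).fderiv_eq, ← (hΓ _).eq_of_nhds, hω'] at hc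
  have hc' := congrArg (fun A => A w) hc
  rw [curv, hd, hd, Ring.lie_def ⁅cmul m u, rot f b p⁆, ← add_sub_assoc]
  exact hc'

/-- The generalized Darboux–Egoroff equations say that the connection form `v ↦ [C_v, γ]` is flat on
pairs of coordinate fields, which suffices by bilinearity. -/
theorem curv_rootConn_eq_zero_iff {F : FStructure m U}
    (hF : ∀ p ∈ U, F.mul p = cmul m) :
    (∀ p ∈ U, ∀ u v w, curv (rootConn f b) p u v w = 0) ↔ F.DarbouxEgoroff (rot f b) := by
  let Ω : Sp m → Sp m → Sp m → (Sp m →L[ℂ] Sp m) := fun p u v =>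
    ⁅cmul m v, fderiv ℂ (rot f b) p u⁆ - ⁅cmul m u, fderiv ℂ (rot f b) p v⁆
      + ⁅⁅cmul m u, rot f b p⁆, ⁅cmul m v, rot f b p⁆⁆
  have hcurv : ∀ p ∈ U, ∀ u v, (∀ w, curv (rootConn f b) p u v w = 0) ↔ Ω p u v = 0 := by
    intro p hp u v
    constructor
    · intro h0
      ext1 w
      have := h0 (cmul m (b p) w)
      rw [h.curv_rootConn hp, h.cmul_root_inv hp] at this
      rw [← h.cmul_root_inv hp (Ω p u v w), this, map_zero]
      rfl
    · intro h0 w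
      rw [h.curv_rootConn hp]
      change cmul m (b p) (Ω p u v _) = 0
      rw [h0, _root_.zero_apply, map_zero]
  have hDE : ∀ p ∈ U, ∀ i j, (⁅F.mul p (dd m i), lieEnd j (rot f b) p⁆
      - ⁅F.mul p (dd m j), lieEnd i (rot f b) p⁆
        = ⁅⁅F.mul p (dd m i), rot f b p⁆, ⁅F.mul p (dd m j), rot f b p⁆⁆) ↔
      Ω p (dd m i) (dd m j) = 0 := by
    intro p hp i j
    rw [hF p hp, ← sub_eq_zero, ← neg_eq_zero]
    refine Eq.congr ?_ rfl
    simp only [Ω, lieEnd]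
    abel
  have hlin : ∀ p u w, IsLinearMap ℂ fun v => Ω p u v w := by
    intro p u w
    constructor
    · intro x y
      simp only [Ω, Ring.lie_def, map_add, map_sub, _root_.add_apply, _root_.sub_apply,
        mul_apply_eq_comp]
      abel
    · intro c x
      simp only [Ω, Ring.lie_def, map_smul, map_sub, _root_.add_apply, _root_.sub_apply,
        _root_.smul_apply, mul_apply_eq_comp]
      module
  have hskew : ∀ p u v, Ω p u v = - Ω p v u := by
    intro p u v
    simp only [Ω, Ring.lie_def]
    noncomm_ring
  have hext : ∀ p u, (∀ j < m, Ω p u (dd m j) = 0) → ∀ v, Ω p u v = 0 := by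
    intro p u h0 v
    ext1 w
    change (hlin p u w).mk' _ v = 0
    rw [← sum_dt_smul_dd v, map_sum]
    refine Finset.sum_eq_zero fun k hk => ?_
    rw [map_smul, IsLinearMap.mk'_apply, h0 k (mem_range.1 hk), _root_.zero_apply, smul_zero]
  constructor
  · intro h0 p hp i _ j _
    exact (hDE p hp i j).2 ((hcurv p hp _ _).1 fun w => h0 p hp _ _ w)
  · intro h0 p hp u v
    refine (hcurv p hp u v).2 (hext p u (fun j hj => ?_) v)
    rw [hskew, hext p _ (fun i hi => (hDE p hp j i).1 (h0 p hp j hj i hi)), neg_zero]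

end IsRoot

end Root

/-! ### Frobenius metrics -/

section Metrics

variable {m : ℕ} {U : Set (Sp m)} {F : FStructure m U} {g : BilField m} {p : Sp m}

namespace FStructure

theorem IsCanonical.mul_eq_cmul (hcan : F.IsCanonical) (hp : p ∈ U) : F.mul p = cmul m :=
  ext_dd fun i _ => ext_dd fun j _ => by rw [hcan.mul_eq p hp, cmul_dd]

theorem IsCanonical.metric_eq (hcan : F.IsCanonical) (hinv : F.IsInvariant g) (hp : p ∈ U)
    (u v : Sp m) : g p u v = g p (dd m 0) (cmul m u v) := by
  have := hinv p hp (dd m 0) u v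
  rwa [hcan.mul_eq_cmul hp, dd_zero_cmul] at this

theorem IsCanonical.eta_eq (hcan : F.IsCanonical) (hg : IsMetric U g) (hp : p ∈ U) (k : ℕ) :
    F.eta g k p = g p (dd m 0) (dd m k) := by
  rw [eta, hcan.e_eq p hp, hg.symm p hp]

theorem IsCanonical.coMul_eq (hcan : F.IsCanonical) (hp : p ∈ U) (φ χ : Sp m →L[ℂ] ℂ) :
    F.coMul p φ χ = eps m (cmul m (sharp φ) (sharp χ)) := by
  rw [coMul, hcan.mul_eq_cmul hp]

/-- Invariance makes `∂_{m-1}` orthogonal to `∂_1, …, ∂_{m-1}`, so non-degeneracy forces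
`η_{m-1} ≠ 0`. -/
theorem IsCanonical.eta_last_ne_zero (hm : 0 < m) (hcan : F.IsCanonical) (hg : IsMetric U g)
    (hinv : F.IsInvariant g) (hp : p ∈ U) : F.eta g (m - 1) p ≠ 0 := by
  intro h0
  rw [hcan.eta_eq hg hp] at h0
  have hz : dd m (m - 1) = 0 := by
    refine hg.nondeg p hp _ fun v => ?_
    suffices h : g p (dd m (m - 1)) = 0 by rw [h, _root_.zero_apply]
    refine ext_dd fun k _ => ?_
    rw [hcan.metric_eq hinv hp, cmul_dd, _root_.zero_apply]
    rcases k.eq_zero_or_pos with rfl | hk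
    · exact h0
    · rw [dd_eq_zero (m := m) (k := m - 1 + k) (by omega), map_zero]
  have := congrFun hz ⟨m - 1, by omega⟩
  simp [dd] at this

theorem isRootOf_iff (hcan : F.IsCanonical) (hinv : F.IsInvariant g) {ψ : OneForm m} :
    F.IsRootOf ψ g ↔ ∀ p ∈ U, eps m (cmul m (sharp (ψ p)) (sharp (ψ p))) = g p (dd m 0) := by
  refine forall₂_congr fun p hp => ⟨fun h => ?_, fun h u v => ?_⟩
  · ext1 v
    rw [h, hcan.coMul_eq hp, hcan.mul_eq_cmul hp, dd_zero_cmul]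
  · rw [hcan.coMul_eq hp, hcan.mul_eq_cmul hp, hcan.metric_eq hinv hp, h]

/-- The recursion expresses the coefficients of `ψ ∘ ψ = g(e, ·)` other than the constant one,
which involves only the top component of `ψ`. -/
theorem eps_cmul_self_of_recursion (hm : 0 < m) (hcan : F.IsCanonical) (hg : IsMetric U g)
    {ψ : OneForm m} (htop : ∀ p ∈ U, ψ p (dd m (m - 1)) ^ 2 = F.eta g (m - 1) p)
    (h : F.Recursion ψ g) (hp : p ∈ U) :
    eps m (cmul m (sharp (ψ p)) (sharp (ψ p))) = g p (dd m 0) := by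
  refine ext_dd fun k hk => ?_
  rw [← hcan.eta_eq hg hp]
  by_cases hk' : k + 1 < m
  · rw [eps_cmul_sharp_dd hk, h p hp k hk']
  · obtain rfl : k = m - 1 := by omega
    rw [← htop p hp, eps_apply_dd hk, Nat.sub_self, dt_cmul hm, Finset.Nat.antidiagonal_zero,
      Finset.sum_singleton, dt_sharp hm, Nat.sub_zero, sq]

end FStructure

/-- The covector `g(e, ·)` is closed if `∇ e = 0`. -/
theorem IsLeviCivita.fderiv_symm {Γ : MulField m} (hΓ : IsLeviCivita U g Γ) (hp : p ∈ U)
    {e : Sp m} (he : ∀ u, Γ p u e = 0) (u v : Sp m) :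
    fderiv ℂ (fun q => g q e v) p u = fderiv ℂ (fun q => g q e u) p v := by
  rw [hΓ.metric p hp, hΓ.metric p hp, he, he, hΓ.torsion_free p hp u v, map_zero,
    _root_.zero_apply, _root_.zero_apply]

theorem curv_congr {Γ Γ' : MulField m} (hU : IsOpen U) (h : Set.EqOn Γ Γ' U) (hp : p ∈ U)
    (u v w : Sp m) : curv Γ p u v w = curv Γ' p u v w := by
  have he : ∀ v, (fun q => Γ q v w) =ᶠ[nhds p] fun q => Γ' q v w := by
    intro v
    filter_upwards [hU.mem_nhds hp] with q hq
    rw [h hq]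
  rw [curv, curv, (he v).fderiv_eq, (he u).fderiv_eq, h hp]

theorem differentiableAt_metric_apply (hg : IsMetric U g) (hp : p ∈ U) (u : Sp m) :
    DifferentiableAt ℂ (fun q => g q u) p :=
  differentiableAt_clm_apply_const (hg.holo p hp).differentiableAt u

theorem fderiv_metric_apply (hg : IsMetric U g) (hp : p ∈ U) (u v w : Sp m) :
    fderiv ℂ (fun q => g q u v) p w = fderiv ℂ (fun q => g q u) p w v :=
  fderiv_clm_apply_const (differentiableAt_metric_apply hg hp u) w v

theorem FStructure.IsCanonical.fderiv_e (hcan : F.IsCanonical) (hp : p ∈ U) (u : Sp m) :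
    fderiv ℂ F.e p u = 0 := by
  have : F.e =ᶠ[nhds p] fun _ => dd m 0 := by
    filter_upwards [F.isOpen.mem_nhds hp] with q hq using hcan.e_eq q hq
  rw [this.fderiv_eq]
  simp

theorem FStructure.IsFrobenius.exists_flat_conn (h : F.IsFrobenius g) (hcan : F.IsCanonical) :
    ∃ Γ : MulField m, IsLeviCivita U g Γ ∧ (∀ p ∈ U, ∀ u v w, curv Γ p u v w = 0) ∧
      ∀ p ∈ U, ∀ u, Γ p u (dd m 0) = 0 := by
  obtain ⟨-, -, Γ, hΓ, hflat, he⟩ := h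
  refine ⟨Γ, hΓ, hflat, fun p hp u => ?_⟩
  have := he p hp u
  rwa [hcan.fderiv_e hp, zero_add, hcan.e_eq p hp] at this

/-- A metric is Frobenius if and only if the coidentity is closed, its component `η_0 = ε(ψ, ψ)`
is constant and the connection form `v ↦ [C_v, γ]` is flat. -/
theorem IsRoot.isFrobenius_iff {f b : VF m} (h : IsRoot U g f b) (hm : 0 < m)
    (hU : IsPreconnected U) (hcan : F.IsCanonical) (hg : IsMetric U g) (hinv : F.IsInvariant g) :
    F.IsFrobenius g ↔ F.FlatCondition (fun p => eps m (f p)) (fun p => eps m (b p)) := by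
  have hF : ∀ p ∈ U, F.mul p = cmul m := fun p hp => hcan.mul_eq_cmul hp
  have hnorm : ∀ p ∈ U, epsDual (eps m (f p)) (eps m (f p)) = g p (dd m 0) (dd m 0) := by
    intro p hp
    rw [epsDual, sharp_eps, h.metric_eq p hp, cmul_comm, dd_zero_cmul]
  have hsymm_iff := h.isEpsSymm_iff hm
  constructor
  · intro hfrob
    obtain ⟨Γ, hΓ, hflat, he⟩ := hfrob.exists_flat_conn hcan
    have hs : IsEpsSymm U (rot f b) := hsymm_iff.2 fun p hp => hΓ.fderiv_symm hp (he p hp)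
    refine ⟨?_, hs, (h.curv_rootConn_eq_zero_iff hF).1 fun p hp u v w => ?_⟩
    · obtain ⟨c, hc⟩ := h.isOpen.exists_is_const_of_fderiv_eq_zero (𝕜 := ℂ)
        (f := fun q => g q (dd m 0) (dd m 0)) hU
        (fun p hp => (differentiableAt_clm_apply_const (differentiableAt_metric_apply hg hp _)
          _).differentiableWithinAt)
        (fun p hp => by
          ext1 u
          rw [hΓ.metric p hp, he p hp, map_zero, map_zero]
          simp)
      exact ⟨c, fun p hp => (hnorm p hp).trans (hc p hp)⟩
    · rw [← curv_congr h.isOpen (hΓ.unique hg (h.isLeviCivita hm hs)) hp, hflat p hp]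
  · rintro ⟨⟨c, hc⟩, hs, hDE⟩
    refine ⟨hg, hinv, rootConn f b, h.isLeviCivita hm hs,
      (h.curv_rootConn_eq_zero_iff hF).2 hDE, fun p hp u => ?_⟩
    -- the coidentity is constant along `e`, hence so is its square root `f`
    have hconst : ∀ v, fderiv ℂ (fun q => g q (dd m 0) v) p (dd m 0) = 0 := by
      intro v
      have : (fun q => g q (dd m 0) (dd m 0)) =ᶠ[nhds p] fun _ => c := by
        filter_upwards [h.isOpen.mem_nhds hp] with q hq
        rw [← hnorm q hq, hc q hq]
      rw [hsymm_iff.1 hs p hp, this.fderiv_eq]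
      simp
    have hf : fderiv ℂ f p (dd m 0) = 0 := by
      rw [← h.cmul_inv_root hp (fderiv ℂ f p (dd m 0))]
      have : cmul m (f p) (fderiv ℂ f p (dd m 0)) = 0 := by
        refine eps_injective (ContinuousLinearMap.ext fun v => ?_)
        have e := hconst v
        rw [h.fderiv_metric hp hm, dd_zero_cmul] at e
        rw [(mul_eq_zero.1 e).resolve_left two_ne_zero]
        simp
      rw [this, map_zero]
    rw [hcan.fderiv_e hp, hcan.e_eq p hp, zero_add, h.rootConn_apply_apply hs hp, hf, cmul_comm u,
      dd_zero_cmul, h.rot_root hp hs, map_zero, _root_.zero_apply, add_zero, cmul_comm _ (dd m 0),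
      dd_zero_cmul, sub_self, map_zero]

/-- The derivative of the Euler field is the identity, whence the two additional copies of `g`. -/
theorem lieBil_euler (hcan : F.IsCanonical) (hp : p ∈ U) (u v : Sp m) :
    lieBil F.E g p u v = fderiv ℂ (fun q => g q u v) p (F.E p) + 2 * g p u v := by
  obtain ⟨a, ha⟩ := hcan.E_eq
  have hE : HasFDerivAt F.E (ContinuousLinearMap.id ℂ (Sp m)) p := by
    have h1 : HasFDerivAt (fun q : Sp m => q + a • dd m 0 + dd m 1)
        (ContinuousLinearMap.id ℂ (Sp m)) p :=
      ((hasFDerivAt_id p).add_const _).add_const _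
    refine h1.congr_of_eventuallyEq ?_
    filter_upwards [F.isOpen.mem_nhds hp] with q hq using ha q hq
  have hbr : ∀ u, VectorField.lieBracket ℂ F.E (fun _ => u) p = -u := by
    intro u
    simp [VectorField.lieBracket, hE.fderiv]
  rw [lieBil, hbr, hbr]
  simp only [map_neg, _root_.neg_apply]
  ring

/-- As the coefficients of `∘` are constant, `g(u, v) = g(e, u ∘ v)` reduces the equation
`L_E g = D g` to the components of the coidentity. -/
theorem lieBil_euler_eq_iff (hcan : F.IsCanonical) (hg : IsMetric U g) (hinv : F.IsInvariant g)
    (D : ℂ) : (∀ p ∈ U, ∀ u v, lieBil F.E g p u v = D * g p u v) ↔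
      ∀ p ∈ U, ∀ i < m, fderiv ℂ (F.eta g i) p (F.E p) = (D - 2) * F.eta g i p := by
  refine forall₂_congr fun p hp => ?_
  have heta : ∀ i, fderiv ℂ (F.eta g i) p (F.E p)
      = fderiv ℂ (fun q => g q (dd m 0) (dd m i)) p (F.E p) := by
    intro i
    have : F.eta g i =ᶠ[nhds p] fun q => g q (dd m 0) (dd m i) := by
      filter_upwards [F.isOpen.mem_nhds hp] with q hq using hcan.eta_eq hg hq i
    rw [this.fderiv_eq]
  constructor
  · intro h i _
    have := h (dd m 0) (dd m i)
    rw [lieBil_euler hcan hp] at this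
    rw [heta, hcan.eta_eq hg hp]
    linear_combination this
  · intro h u v
    have hcov : fderiv ℂ (fun q => g q (dd m 0)) p (F.E p) = (D - 2) • g p (dd m 0) := by
      refine ext_dd fun i hi => ?_
      rw [← fderiv_metric_apply hg hp, ← heta, h i hi, hcan.eta_eq hg hp]
      rfl
    have heq : (fun q => g q u v) =ᶠ[nhds p] fun q => g q (dd m 0) (cmul m u v) := by
      filter_upwards [F.isOpen.mem_nhds hp] with q hq using hcan.metric_eq hinv hq u v
    rw [lieBil_euler hcan hp, heq.fderiv_eq, fderiv_metric_apply hg hp, hcov,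
      hcan.metric_eq hinv hp u v, _root_.smul_apply, smul_eq_mul]
    ring

/-- The coidentity `g(e, ·)` of a Frobenius metric has local potentials, and its components do
not depend on `t^0`. -/
theorem FStructure.IsFrobenius.exists_potential (h : F.IsFrobenius g) (hcan : F.IsCanonical)
    (hp : p ∈ U) :
    ∃ W ⊆ U, IsOpen W ∧ p ∈ W ∧ ∃ H : Sp m → ℂ, AnalyticOnNhd ℂ H W ∧
      (∀ q ∈ W, ∀ i < m, F.eta g i q = fderiv ℂ H q (dd m i)) ∧
      ∀ q ∈ W, ∀ q' ∈ W, (∀ j : Fin m, (j : ℕ) ≠ 0 → q j = q' j) →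
        ∀ i < m, fderiv ℂ H q (dd m i) = fderiv ℂ H q' (dd m i) := by
  have hg := h.1
  obtain ⟨Γ, hΓ, -, he⟩ := h.exists_flat_conn hcan
  obtain ⟨ε, hε, hW⟩ := Metric.isOpen_iff.1 F.isOpen p hp
  obtain ⟨H, hH, hHd⟩ := exists_analytic_potential Metric.isOpen_ball (convex_ball p ε)
    (ω := fun q => g q (dd m 0))
    (analyticOnNhd_clm_apply_const (fun q hq => hg.holo q (hW hq)) _)
    (fun q hq u v => by
      rw [← fderiv_metric_apply hg (hW hq), ← fderiv_metric_apply hg (hW hq),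
        hΓ.fderiv_symm (hW hq) (he q (hW hq))])
  refine ⟨_, hW, Metric.isOpen_ball, Metric.mem_ball_self hε, H, hH, fun q hq i _ => ?_,
    fun q hq q' hq' hqq' i _ => ?_⟩
  · rw [(hHd q hq).fderiv, hcan.eta_eq hg (hW hq)]
  · rw [(hHd q hq).fderiv, (hHd q' hq').fderiv]
    have hline : q' - q = dt m 0 (q' - q) • dd m 0 := by
      ext j
      by_cases hj : (j : ℕ) = 0
      · have h0 : dt m 0 (q' - q) = (q' - q) j := by
          rw [dt_apply, dif_pos (hj ▸ j.2)]
          exact congrArg _ (Fin.ext hj.symm)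
        simp [h0, dd, hj]
      · simp [dd, hj, hqq' j hj]
    -- `∇ e = 0` makes the components of the coidentity constant along `e`
    have := eq_of_fderiv_eq_zero_on_line Metric.isOpen_ball (convex_ball p ε)
      (φ := fun q => g q (dd m 0) (dd m i))
      (fun q hq => differentiableAt_clm_apply_const
        (differentiableAt_metric_apply hg (hW hq) _) _) (q := q) (x := q' - q)
      (fun s hs => by
        rw [hline, map_smul, hΓ.metric _ (hline ▸ hW hs), he _ (hline ▸ hW hs),
          hΓ.torsion_free _ (hline ▸ hW hs) (dd m 0), he _ (hline ▸ hW hs)]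
        simp)
      hq (by simpa using hq')
    simpa using this.symm

end Metrics

end FMan

theorem mainTheorem6 {m : ℕ} (hm : 0 < m) {U : Set (Sp m)} (hU : IsPreconnected U)
    (F : FStructure m U) (hreg : F.IsRegular) (hnil : F.IsGloballyNilpotent)
    (hcan : F.IsCanonical)
    (g : BilField m) (hg : IsMetric U g) (hinv : F.IsInvariant g)
    (r : Sp m → ℂ) (hr : AnalyticOnNhd ℂ r U) (hr2 : ∀ p ∈ U, r p ^ 2 = F.eta g (m - 1) p) :
    -- `g = η_{i+j} dt^i ⊗ dt^j`
    (∀ p ∈ U, ∀ i j, g p (dd m i) (dd m j) = F.eta g (i + j) p) ∧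
    ∃ ψ β : OneForm m,
      -- (i) existence, the top component and the recursion for the others
      (AnalyticOnNhd ℂ ψ U ∧ F.IsInvertible ψ ∧ F.IsRootOf ψ g ∧
        (∀ p ∈ U, ψ p (dd m (m - 1)) = r p) ∧ F.Recursion ψ g) ∧
      -- (i) uniqueness, and the recursion determines `ψ`
      (∀ ψ' : OneForm m, (∀ p ∈ U, ψ' p (dd m (m - 1)) = r p) →
        F.IsRootOf ψ' g ∨ F.Recursion ψ' g → Set.EqOn ψ' ψ U) ∧
      -- `β` is the inverse of `ψ`
      (AnalyticOnNhd ℂ β U ∧ F.IsInverse ψ β) ∧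
      -- (ii)
      (∀ p ∈ U, epsDual (ψ p) (ψ p)
        = ∑ x ∈ antidiagonal (m - 1), ψ p (dd m x.1) * ψ p (dd m x.2)) ∧
      (F.IsFrobenius g ↔ F.FlatCondition ψ β) ∧
      (F.IsFrobenius g → ∀ p ∈ U, ∃ W ⊆ U, IsOpen W ∧ p ∈ W ∧
        ∃ H : Sp m → ℂ, AnalyticOnNhd ℂ H W ∧
          (∀ q ∈ W, ∀ i < m, F.eta g i q = fderiv ℂ H q (dd m i)) ∧
          ∀ q ∈ W, ∀ q' ∈ W, (∀ j : Fin m, (j : ℕ) ≠ 0 → q j = q' j) →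
            ∀ i < m, fderiv ℂ H q (dd m i) = fderiv ℂ H q' (dd m i)) ∧
      -- (iii)
      (F.IsFrobeniusEuler g ↔ F.FlatCondition ψ β ∧
        ∃ D : ℂ, ∀ p ∈ U, ∀ i < m, fderiv ℂ (F.eta g i) p (F.E p) = (D - 2) * F.eta g i p) ∧
      (∀ D : ℂ, F.IsFrobeniusEulerWith g D ↔ F.FlatCondition ψ β ∧
        ∀ p ∈ U, ∀ i < m, fderiv ℂ (F.eta g i) p (F.E p) = (D - 2) * F.eta g i p) := by
  have hr0 : ∀ p ∈ U, r p ≠ 0 := fun p hp h0 =>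
    hcan.eta_last_ne_zero hm hg hinv hp (by rw [← hr2 p hp, h0, zero_pow two_ne_zero])
  -- the vector field `ε`-dual to the coidentity, its square root and the inverse of that root
  let h : VF m := fun p => sharp (g p (dd m 0))
  let f : VF m := fun p => csqrt (r p) (h p)
  let b : VF m := fun p => cinv (f p)
  have hh : AnalyticOnNhd ℂ h U := by
    refine Finset.analyticOnNhd_fun_sum _ fun x _ => .smul ?_ analyticOnNhd_const
    exact analyticOnNhd_clm_apply_const (analyticOnNhd_clm_apply_const hg.holo _) _
  have h0 : ∀ p ∈ U, r p ^ 2 = dt m 0 (h p) := by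
    intro p hp
    rw [hr2 p hp, hcan.eta_eq hg hp, dt_sharp hm, Nat.sub_zero]
  have hf0 : ∀ p, dt m 0 (f p) = r p := fun p => dt_zero_csqrt hm _ _
  have hff : ∀ p ∈ U, cmul m (f p) (f p) = h p := fun p hp => cmul_csqrt_self (hr0 p hp) (h0 p hp)
  have hunit : ∀ p ∈ U, dt m 0 (f p) ≠ 0 := fun p hp => by
    rw [hf0]
    exact hr0 p hp
  have hfa : AnalyticOnNhd ℂ f U := analyticOnNhd_csqrt hr hh hr0
  have hroot : IsRoot U g f b :=
    { isOpen := F.isOpen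
      holo := hfa
      inv_holo := analyticOnNhd_cinv hfa hunit
      mul_inv := fun p hp => cmul_cinv (hunit p hp)
      metric_eq := fun p hp u v => by
        rw [hcan.metric_eq hinv hp, ← eps_sharp_eq (g p (dd m 0))]
        change eps m (h p) _ = _
        rw [← hff p hp, eps_cmul_left hm, eps_cmul_left hm, cmul_left_comm u] }
  have hrootOf : F.IsRootOf (fun p => eps m (f p)) g := by
    refine (F.isRootOf_iff hcan hinv).2 fun p hp => ?_
    rw [sharp_eps, hff p hp, eps_sharp_eq]
  have htop : ∀ p, eps m (f p) (dd m (m - 1)) = r p := by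
    intro p
    rw [eps_apply_dd (by omega), Nat.sub_self, hf0]
  have hinverse : F.IsInverse (fun p => eps m (f p)) fun p => eps m (b p) := by
    intro p hp
    rw [hcan.coMul_eq hp, sharp_eps, sharp_eps, hroot.mul_inv p hp, hcan.e_eq p hp]
  have hfrob := hroot.isFrobenius_iff hm hU hcan hg hinv
  have hwith : ∀ D : ℂ, F.IsFrobeniusEulerWith g D ↔
      F.FlatCondition (fun p => eps m (f p)) (fun p => eps m (b p)) ∧
        ∀ p ∈ U, ∀ i < m, fderiv ℂ (F.eta g i) p (F.E p) = (D - 2) * F.eta g i p := fun D =>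
    and_congr hfrob (lieBil_euler_eq_iff hcan hg hinv D)
  refine ⟨fun p hp i j => by rw [hcan.metric_eq hinv hp, cmul_dd, hcan.eta_eq hg hp],
    fun p => eps m (f p), fun p => eps m (b p),
    ⟨(eps m).comp_analyticOnNhd hfa, fun p hp => ⟨_, hinverse p hp⟩, hrootOf,
      fun p _ => htop p, fun p hp k hk => ?_⟩, fun ψ' htop' hψ' p hp => ?_,
    ⟨(eps m).comp_analyticOnNhd hroot.inv_holo, hinverse⟩, fun p _ => ?_, hfrob,
    fun hfr p hp => hfr.exists_potential hcan hp, ?_, hwith⟩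
  · rw [← eps_cmul_sharp_dd (by omega), (F.isRootOf_iff hcan hinv).1 hrootOf p hp,
      hcan.eta_eq hg hp]
  · have hsq : eps m (cmul m (sharp (ψ' p)) (sharp (ψ' p))) = g p (dd m 0) := by
      rcases hψ' with hψ' | hψ'
      · exact (F.isRootOf_iff hcan hinv).1 hψ' p hp
      · exact FStructure.eps_cmul_self_of_recursion hm hcan hg
          (fun q hq => by rw [htop' q hq, hr2 q hq]) hψ' hp
    have : sharp (ψ' p) = f p := by
      refine eq_of_cmul_self_eq ?_ (hunit p hp) (eps_injective ?_)
      · rw [hf0, dt_sharp hm, Nat.sub_zero, htop' p hp]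
      · rw [hsq, hff p hp, eps_sharp_eq]
    rw [← eps_sharp_eq (ψ' p), this]
  · rw [epsDual, eps_sharp]
    simp only [sharp, map_sum, map_smul, smul_eq_mul]
  · simp only [FStructure.IsFrobeniusEuler, hwith, exists_and_left]
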